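/- For $n\ge 1$ the augmented cube $AQ_n$ is the graph on the binary strings of length $n$ defined recursively: $AQ_1=K_2$, and for $n\ge 2$ the graph $AQ_n$ consists of two copies of $AQ_{n-1}$, whose vertices are the strings $0a_{n-1}\cdots a_1$ and $1b_{n-1}\cdots b_1$ respectively, together with the edges joining $0a_{n-1}\cdots a_1$ to $1b_{n-1}\cdots b_1$ whenever $a_i=b_i$ for all $i\in\{1,\dots,n-1\}$ or $a_i=1-b_i$ for all $i\in\{1,\dots,n-1\}$. A drawing of a graph in the plane represents vertices by distinct points and each edge by a continuous curve joining its two ends and passing through no vertex otherwise. It is a good drawing if no edge crosses itself, adjacent edges do not cross each other, two edges cross at most once, edges do not touch (any common inner point of two edges is a proper crossing), and no three edges cross in a point. The crossing number $cr(G)$ is the minimum number of crossings in a good drawing of $G$. Then $AQ_4$, $AQ_5$, $AQ_6$ and $AQ_7$ have good drawings in the plane with exactly $46$, $328$, $1848$ and $9112$ crossings, respectively. Hence $$cr(AQ_4)\le 46,\qquad cr(AQ_5)\le 328,\qquad cr(AQ_6)\le 1848,\qquad cr(AQ_7)\le 9112.$$ -/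

import Mathlib

/-- The `n`-dimensional augmented cube `AQ_n`. A vertex `a_n a_{n-1} ⋯ a_1` is a function
`Fin n → Bool` whose value at `0` is the leading bit `a_n`, so that `Fin.tail a` is
`a_{n-1} ⋯ a_1`. `AQ_1` is `K_2`, and `AQ_n` consists of two copies of `AQ_{n-1}` (leading bit
`0` and `1`), where two vertices in different copies are adjacent iff their remaining bits all
agree or are all complementary. (`AQ_0`, a single vertex, is a convention.) -/
def augmentedCube : (n : ℕ) → SimpleGraph (Fin n → Bool)
  | 0 => ⊥
  | 1 => ⊤
  | n + 2 =>
    { Adj := fun a b =>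
        (a 0 = b 0 ∧ (augmentedCube (n + 1)).Adj (Fin.tail a) (Fin.tail b)) ∨
        (a 0 ≠ b 0 ∧
          ((∀ i, Fin.tail a i = Fin.tail b i) ∨ (∀ i, Fin.tail a i = !(Fin.tail b i))))
      symm := ⟨by
        rintro a b (⟨h, h'⟩ | ⟨h, h' | h'⟩)
        · exact Or.inl ⟨h.symm, h'.symm⟩
        · exact Or.inr ⟨h.symm, Or.inl fun i => (h' i).symm⟩
        · exact Or.inr ⟨h.symm, Or.inr fun i => by rw [h' i, Bool.not_not]⟩⟩
      loopless := ⟨by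
        rintro a (⟨-, h⟩ | ⟨h, -⟩)
        · exact h.ne rfl
        · exact h rfl⟩ }

/-- A drawing of a graph in the plane `ℝ × ℝ`: vertices are distinct points, every edge is a
continuous curve joining its two end vertices, and no edge passes through a vertex on its way. -/
structure PlaneDrawing {V : Type*} (G : SimpleGraph V) where
  /-- the point representing a vertex -/
  point : V → ℝ × ℝ
  point_injective : Function.Injective point
  /-- the curve representing an edge -/
  curve : G.edgeSet → C(unitInterval, ℝ × ℝ)
  curve_ends : ∀ e : G.edgeSet, s(curve e 0, curve e 1) = (e : Sym2 V).map point
  curve_avoids : ∀ (e : G.edgeSet) (t : unitInterval) (v : V),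
    curve e t = point v → t = 0 ∨ t = 1

/-- Two subsets of the plane cross properly at the point `p`: some homeomorphism from a
neighbourhood of `p` onto an open subset of the plane takes `p` to the origin and takes the two
sets, within that neighbourhood, to the horizontal and to the vertical coordinate axis. -/
def CrossProperlyAt (A B : Set (ℝ × ℝ)) (p : ℝ × ℝ) : Prop :=
  ∃ φ : OpenPartialHomeomorph (ℝ × ℝ) (ℝ × ℝ), p ∈ φ.source ∧ φ p = (0, 0) ∧
    ∀ q ∈ φ.source, (q ∈ A ↔ (φ q).2 = 0) ∧ (q ∈ B ↔ (φ q).1 = 0)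

namespace PlaneDrawing

variable {V : Type*} {G : SimpleGraph V}

/-- The points of an edge other than its two ends. -/
def inner (D : PlaneDrawing G) (e : G.edgeSet) : Set (ℝ × ℝ) :=
  D.curve e '' Set.Ioo 0 1

/-- A good drawing. -/
structure IsGood (D : PlaneDrawing G) : Prop where
  /-- no edge crosses itself -/
  simple : ∀ e, Function.Injective (D.curve e)
  /-- adjacent edges do not cross -/
  adjacent : ∀ e f : G.edgeSet, e ≠ f → (∃ v : V, v ∈ (e : Sym2 V) ∧ v ∈ (f : Sym2 V)) →
    Disjoint (D.inner e) (D.inner f)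
  /-- two edges cross at most once -/
  once : ∀ e f : G.edgeSet, e ≠ f → (D.inner e ∩ D.inner f).Subsingleton
  /-- edges do not touch: where they meet in an inner point, they cross -/
  proper : ∀ e f : G.edgeSet, e ≠ f → ∀ p ∈ D.inner e ∩ D.inner f,
    CrossProperlyAt (D.inner e) (D.inner f) p
  /-- no three edges cross in a point -/
  no_triple : ∀ e f g : G.edgeSet, e ≠ f → f ≠ g → e ≠ g →
    D.inner e ∩ D.inner f ∩ D.inner g = ∅

/-- The number of crossings of a drawing: the number of pairs that consist of an unordered pair
of distinct edges and a common inner point of the two. -/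
noncomputable def crossings (D : PlaneDrawing G) : ℕ∞ :=
  {c : Sym2 G.edgeSet × (ℝ × ℝ) | ∃ e f : G.edgeSet, e ≠ f ∧ c.1 = s(e, f) ∧
    c.2 ∈ D.inner e ∩ D.inner f}.encard

end PlaneDrawing

/-- The crossing number of a graph: the minimum number of crossings in a good drawing
(and `⊤` if there is no good drawing). -/
noncomputable def crossingNumber {V : Type*} (G : SimpleGraph V) : ℕ∞ :=
  ⨅ (D : PlaneDrawing G) (_ : D.IsGood), D.crossings

/-! The bounds are witnessed by one explicit straight-line drawing for each cube, with vertices at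
grid points whose coordinates are below `2 ^ 18`. If the line through an edge contains no vertices
but the two ends of that edge, almost every requirement of a good drawing is automatic: adjacent
edges lie on different lines through their common end, and two other edges meet at most once, and
then transversally (`crossProperlyAt_of_mem`). Only triple points remain to be excluded. The
crossings are the pairs of edges whose open segments meet, and this is decided by the signs of four
orientations (`openSegment_inter_nonempty_iff`).

For triple points, fix an edge `e`. The place where an edge `f` crosses it is determined by the
ratio of the areas of the two triangles that `f` spans with the ends of `e`. Two edges that cross
`e` in the same point give the same ratio (`orient_mul_eq_of_concurrent`), so it is enough that
these ratios are distinct for every `e`.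

What is left is a finite computation, with 832 edges for `AQ_7`, which the kernel carries out. As
both terms of an orientation are affine in the data of either segment, one edge can be compared with
all earlier edges at once: their data are packed into 40-bit lanes of large numbers, and one bit per
lane gives the sign. `checkCube_spec` states what a successful check proves, and
`exists_good_drawing_of_checkCube` carries this over to the plane. -/

/-! ### Orientations and crossings of open segments -/

/-- Twice the signed area of the triangle `p q r`. -/
def orient (p q r : ℝ × ℝ) : ℝ := (q.1 - p.1) * (r.2 - p.2) - (q.2 - p.2) * (r.1 - p.1)

theorem orient_swap (p q r : ℝ × ℝ) : orient q p r = -orient p q r := by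
  unfold orient; ring

theorem mem_openSegment_iff_coord {a b p : ℝ × ℝ} :
    p ∈ openSegment ℝ a b ↔ ∃ t : ℝ, 0 < t ∧ t < 1 ∧
      p.1 = (1 - t) * a.1 + t * b.1 ∧ p.2 = (1 - t) * a.2 + t * b.2 := by
  rw [openSegment_eq_image]
  constructor
  · rintro ⟨t, ⟨h0, h1⟩, rfl⟩
    exact ⟨t, h0, h1, by simp, by simp⟩
  · rintro ⟨t, h0, h1, hx, hy⟩
    exact ⟨t, ⟨h0, h1⟩, by ext <;> simp [hx, hy]⟩

theorem orient_eq_zero_of_mem_openSegment {a b p : ℝ × ℝ} (h : p ∈ openSegment ℝ a b) :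
    orient a b p = 0 := by
  obtain ⟨t, -, -, hx, hy⟩ := mem_openSegment_iff_coord.1 h
  unfold orient; rw [hx, hy]; ring

theorem orient_combination {a b c d p : ℝ × ℝ} {t : ℝ}
    (hx : p.1 = (1 - t) * c.1 + t * d.1) (hy : p.2 = (1 - t) * c.2 + t * d.2) :
    orient a b p = (1 - t) * orient a b c + t * orient a b d := by
  unfold orient; rw [hx, hy]; ring

/-- Along the ray from `v` to `b` the orientation with respect to `v a` is linear and vanishes only
at `v`. -/
theorem disjoint_openSegment_of_orient_ne_zero {v a b : ℝ × ℝ} (h : orient v a b ≠ 0) :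
    Disjoint (openSegment ℝ v a) (openSegment ℝ v b) := by
  refine Set.disjoint_left.2 fun p hp hq => h ?_
  have h0 := orient_eq_zero_of_mem_openSegment hp
  obtain ⟨s, hs, -, hx, hy⟩ := mem_openSegment_iff_coord.1 hq
  rw [orient_combination hx hy] at h0
  have : orient v a v = 0 := by unfold orient; ring
  rw [this, mul_zero, zero_add] at h0
  exact (mul_eq_zero.1 h0).resolve_left hs.ne'

theorem mul_neg_of_combination_eq_zero {x y t : ℝ} (h0 : 0 < t) (h1 : t < 1) (hx : x ≠ 0)
    (h : (1 - t) * x + t * y = 0) : x * y < 0 := by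
  have hy : y = -((1 - t) / t * x) := by field_simp; linarith
  have : 0 < (1 - t) / t * x ^ 2 := by
    have : 0 < 1 - t := by linarith
    positivity
  rw [hy]; nlinarith

/-- The orientation with respect to one line is affine along the other segment, so a zero inside
that segment forces opposite signs at its ends. Conversely, values `x`, `y` of opposite signs give
the zero at the parameter `x / (x - y)`. -/
theorem openSegment_inter_nonempty_iff {a b c d : ℝ × ℝ} (hc : orient a b c ≠ 0)
    (ha : orient c d a ≠ 0) :
    (openSegment ℝ a b ∩ openSegment ℝ c d).Nonempty ↔
      orient a b c * orient a b d < 0 ∧ orient c d a * orient c d b < 0 := by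
  constructor
  · rintro ⟨p, hp, hq⟩
    have h1 := orient_eq_zero_of_mem_openSegment hp
    have h2 := orient_eq_zero_of_mem_openSegment hq
    obtain ⟨t, ht0, ht1, htx, hty⟩ := mem_openSegment_iff_coord.1 hp
    obtain ⟨s, hs0, hs1, hsx, hsy⟩ := mem_openSegment_iff_coord.1 hq
    rw [orient_combination hsx hsy] at h1
    rw [orient_combination htx hty] at h2
    exact ⟨mul_neg_of_combination_eq_zero hs0 hs1 hc h1, mul_neg_of_combination_eq_zero ht0 ht1 ha h2⟩
  · rintro ⟨h1, h2⟩
    have key : ∀ x y : ℝ, x * y < 0 → x - y ≠ 0 ∧ 0 < x / (x - y) ∧ x / (x - y) < 1 := by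
      intro x y h
      rcases mul_neg_iff.1 h with ⟨hx, hy⟩ | ⟨hx, hy⟩
      · have : 0 < x - y := by linarith
        exact ⟨this.ne', by positivity, (div_lt_one this).2 (by linarith)⟩
      · have : x - y < 0 := by linarith
        exact ⟨this.ne, div_pos_of_neg_of_neg hx this, (div_lt_one_of_neg this).2 (by linarith)⟩
    obtain ⟨hs, hs0, hs1⟩ := key _ _ h1
    obtain ⟨ht, ht0, ht1⟩ := key _ _ h2
    set s := orient a b c / (orient a b c - orient a b d) with hsd
    set t := orient c d a / (orient c d a - orient c d b) with htd
    refine ⟨((1 - t) * a.1 + t * b.1, (1 - t) * a.2 + t * b.2),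
      mem_openSegment_iff_coord.2 ⟨t, ht0, ht1, rfl, rfl⟩,
      mem_openSegment_iff_coord.2 ⟨s, hs0, hs1, ?_, ?_⟩⟩
    all_goals
      simp only [hsd, htd]
      -- Up to sign, both denominators are the cross product of the two directions, so both
      -- parametrizations give the same point.
      have e : orient c d a - orient c d b = -(orient a b c - orient a b d) := by
        unfold orient; ring
      rw [e] at ht ⊢
      field_simp
      unfold orient
      ring

/-- An affine function along `c d` that is nonzero at `c` has at most one zero. -/
theorem openSegment_inter_subsingleton {a b c d : ℝ × ℝ} (hc : orient a b c ≠ 0) :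
    (openSegment ℝ a b ∩ openSegment ℝ c d).Subsingleton := by
  rintro p ⟨hp, hp'⟩ q ⟨hq, hq'⟩
  have h1 := orient_eq_zero_of_mem_openSegment hp
  have h2 := orient_eq_zero_of_mem_openSegment hq
  obtain ⟨t, ht0, ht1, htx, hty⟩ := mem_openSegment_iff_coord.1 hp'
  obtain ⟨s, hs0, hs1, hsx, hsy⟩ := mem_openSegment_iff_coord.1 hq'
  rw [orient_combination htx hty] at h1
  rw [orient_combination hsx hsy] at h2
  have hst : s = t := by
    by_contra hne
    have h3 : (s - t) * (orient a b d - orient a b c) = 0 := by linear_combination h2 - h1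
    have h4 : orient a b d = orient a b c :=
      sub_eq_zero.1 ((mul_eq_zero.1 h3).resolve_left (sub_ne_zero.2 hne))
    rw [h4] at h1
    exact hc (by linear_combination h1)
  subst hst
  ext
  · rw [htx, hsx]
  · rw [hty, hsy]

/-- If `p` has parameter `t` on `a b`, the values at `a` and `b` of both orientations satisfy `(1 -
t) * x + t * y = 0` with the same `t`, so the two pairs are proportional. -/
theorem orient_mul_eq_of_concurrent {a b c d c' d' p : ℝ × ℝ} (hp : p ∈ openSegment ℝ a b)
    (hq : p ∈ openSegment ℝ c d) (hr : p ∈ openSegment ℝ c' d') :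
    orient c d a * orient c' d' b = orient c d b * orient c' d' a := by
  obtain ⟨t, ht0, ht1, hx, hy⟩ := mem_openSegment_iff_coord.1 hp
  have h1 := orient_eq_zero_of_mem_openSegment hq
  have h2 := orient_eq_zero_of_mem_openSegment hr
  rw [orient_combination hx hy] at h1 h2
  have h3 : (1 - t) * (orient c d a * orient c' d' b - orient c d b * orient c' d' a) = 0 := by
    linear_combination orient c' d' b * h1 - orient c d b * h2
  have := (mul_eq_zero.1 h3).resolve_left (by linarith)
  linarith

/-- The affine coordinate system with origin `p` in which the points on the line through `p` in
direction `u` have second coordinate `0` and those in direction `w` have first coordinate `0`. -/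
noncomputable def crossHomeomorph (p u w : ℝ × ℝ) (h : u.1 * w.2 - u.2 * w.1 ≠ 0) :
    (ℝ × ℝ) ≃ₜ (ℝ × ℝ) where
  toFun q := (w.1 * (q.2 - p.2) - w.2 * (q.1 - p.1), u.1 * (q.2 - p.2) - u.2 * (q.1 - p.1))
  invFun z := (p.1 + (z.2 * w.1 - z.1 * u.1) / (u.1 * w.2 - u.2 * w.1),
    p.2 + (z.2 * w.2 - z.1 * u.2) / (u.1 * w.2 - u.2 * w.1))
  left_inv q := by ext <;> simp only <;> field_simp <;> ring
  right_inv z := by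
    ext <;> simp only [add_sub_cancel_left] <;>
      rw [← mul_div_assoc, ← mul_div_assoc, ← sub_div, div_eq_iff h] <;> ring
  continuous_toFun := by fun_prop
  continuous_invFun := by fun_prop

/-- The chart has the two orientations as its coordinates. It must be restricted to a neighbourhood
in which the open segments agree with their lines. -/
theorem crossProperlyAt_of_mem {a b c d p : ℝ × ℝ} (hc : orient a b c ≠ 0) (ha : orient c d a ≠ 0)
    (hp : p ∈ openSegment ℝ a b) (hq : p ∈ openSegment ℝ c d) :
    CrossProperlyAt (openSegment ℝ a b) (openSegment ℝ c d) p := by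
  obtain ⟨h1, h2⟩ := (openSegment_inter_nonempty_iff hc ha).1 ⟨p, hp, hq⟩
  have e1 := orient_eq_zero_of_mem_openSegment hp
  have e2 := orient_eq_zero_of_mem_openSegment hq
  have hΔ : (b.1 - a.1) * (d.2 - c.2) - (b.2 - a.2) * (d.1 - c.1) ≠ 0 := by
    intro h
    have : orient a b d = orient a b c := by
      unfold orient; linear_combination h
    rw [this] at h1
    nlinarith [sq_nonneg (orient a b c)]
  let Φ := crossHomeomorph p (b.1 - a.1, b.2 - a.2) (d.1 - c.1, d.2 - c.2) hΔ
  have Φ1 : ∀ q, (Φ q).1 = orient c d q := fun q => by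
    have : (Φ q).1 = orient c d q - orient c d p := by
      simp only [Φ, crossHomeomorph, orient, Homeomorph.homeomorph_mk_coe, Equiv.coe_fn_mk]; ring
    rw [this, e2, sub_zero]
  have Φ2 : ∀ q, (Φ q).2 = orient a b q := fun q => by
    have : (Φ q).2 = orient a b q - orient a b p := by
      simp only [Φ, crossHomeomorph, orient, Homeomorph.homeomorph_mk_coe, Equiv.coe_fn_mk]; ring
    rw [this, e1, sub_zero]
  have between : ∀ x y t : ℝ, x * y < 0 →
      (((1 - t) * x + t * y - x) * ((1 - t) * x + t * y - y) < 0 ↔ 0 < t ∧ t < 1) := by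
    intro x y t h
    have hxy : 0 < (x - y) ^ 2 := by
      have : x - y ≠ 0 := by
        intro h'
        have : x = y := by linarith
        rw [this] at h; nlinarith [sq_nonneg y]
      positivity
    have : ((1 - t) * x + t * y - x) * ((1 - t) * x + t * y - y) = -(t * (1 - t)) * (x - y) ^ 2 := by
      ring
    rw [this, mul_neg_iff]
    constructor
    · rintro (⟨_, h'⟩ | ⟨h', _⟩)
      · linarith
      · constructor <;> by_contra! hcon <;> nlinarith
    · rintro ⟨h0, h1⟩
      exact Or.inr ⟨by nlinarith, hxy⟩
  -- The open parallelogram with sides parallel to the two segments and an end of one of them on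
  -- each side: each line meets it in the open segment only.
  let U : Set (ℝ × ℝ) := {q | (orient c d q - orient c d a) * (orient c d q - orient c d b) < 0 ∧
    (orient a b q - orient a b c) * (orient a b q - orient a b d) < 0}
  have hU : IsOpen U := by
    have (x y : ℝ) (a b : ℝ × ℝ) :
        IsOpen {q | (orient a b q - x) * (orient a b q - y) < 0} :=
      isOpen_lt (by unfold orient; fun_prop) continuous_const
    exact (this _ _ c d).inter (this _ _ a b)
  refine ⟨Φ.toOpenPartialHomeomorph.restrOpen U hU, ?_, ?_, ?_⟩
  · obtain ⟨t, ht0, ht1, htx, hty⟩ := mem_openSegment_iff_coord.1 hp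
    obtain ⟨s, hs0, hs1, hsx, hsy⟩ := mem_openSegment_iff_coord.1 hq
    refine ⟨Set.mem_univ _, ?_, ?_⟩
    · rw [orient_combination htx hty]
      exact (between _ _ _ h2).2 ⟨ht0, ht1⟩
    · rw [orient_combination hsx hsy]
      exact (between _ _ _ h1).2 ⟨hs0, hs1⟩
  · change Φ p = (0, 0)
    exact Prod.ext ((Φ1 p).trans e2) ((Φ2 p).trans e1)
  · rintro q ⟨-, hq1, hq2⟩
    change (_ ↔ (Φ q).2 = 0) ∧ (_ ↔ (Φ q).1 = 0)
    rw [Φ1, Φ2]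
    have online : ∀ a b c d : ℝ × ℝ, orient c d a * orient c d b < 0 →
        (b.1 - a.1) * (d.2 - c.2) - (b.2 - a.2) * (d.1 - c.1) ≠ 0 →
        (orient c d q - orient c d a) * (orient c d q - orient c d b) < 0 →
        (q ∈ openSegment ℝ a b ↔ orient a b q = 0) := by
      intro a b c d h hΔ hq
      refine ⟨orient_eq_zero_of_mem_openSegment, fun h0 => ?_⟩
      set Δ := (b.1 - a.1) * (d.2 - c.2) - (b.2 - a.2) * (d.1 - c.1) with hΔd
      have h0' : (b.1 - a.1) * (q.2 - a.2) = (b.2 - a.2) * (q.1 - a.1) := by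
        unfold orient at h0; linarith
      -- Cramer's rule: the cross product of `q - a = t (b - a)` with `d - c`.
      let t := ((q.1 - a.1) * (d.2 - c.2) - (q.2 - a.2) * (d.1 - c.1)) / Δ
      have hx : q.1 = (1 - t) * a.1 + t * b.1 := by
        simp only [t]; field_simp; rw [hΔd]; linear_combination (d.1 - c.1) * h0'
      have hy : q.2 = (1 - t) * a.2 + t * b.2 := by
        simp only [t]; field_simp; rw [hΔd]; linear_combination (d.2 - c.2) * h0'
      rw [orient_combination hx hy] at hq
      obtain ⟨ht0, ht1⟩ := (between _ _ _ h).1 hq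
      exact mem_openSegment_iff_coord.2 ⟨t, ht0, ht1, hx, hy⟩
    refine ⟨online a b c d h2 hΔ hq1, online c d a b h1 ?_ hq2⟩
    exact fun h => hΔ (by linarith)

/-! ### Straight-line drawings in general position -/

/-- The open segment that joins the points of an unordered pair. -/
def openSegmentOf {V : Type*} (P : V → ℝ × ℝ) : Sym2 V → Set (ℝ × ℝ) :=
  Sym2.lift ⟨fun a b => openSegment ℝ (P a) (P b), fun _ _ => openSegment_symm ℝ _ _⟩

@[simp]
theorem openSegmentOf_mk {V : Type*} (P : V → ℝ × ℝ) (a b : V) :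
    openSegmentOf P s(a, b) = openSegment ℝ (P a) (P b) := rfl

section StraightLineDrawing

variable {V : Type*} {G : SimpleGraph V} {P : V → ℝ × ℝ}

/-- No point of `P` lies on the line through the two ends of an edge, except for these ends. -/
def EdgesInGeneralPosition (G : SimpleGraph V) (P : V → ℝ × ℝ) : Prop :=
  ∀ a b v, G.Adj a b → v ≠ a → v ≠ b → orient (P a) (P b) (P v) ≠ 0

theorem lineMap_injective_real {a b : ℝ × ℝ} (h : a ≠ b) :
    Function.Injective (AffineMap.lineMap a b : ℝ → ℝ × ℝ) :=
  AffineMap.lineMap_injective ℝ h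

/-- The straight-line drawing of a graph. -/
noncomputable def straightLineDrawing (hP : Function.Injective P)
    (hG : EdgesInGeneralPosition G P) : PlaneDrawing G where
  point := P
  point_injective := hP
  curve e := ⟨fun t => AffineMap.lineMap (P (Quot.out e.1).1) (P (Quot.out e.1).2) (t : ℝ), by
    simp only [AffineMap.lineMap_apply]; fun_prop⟩
  curve_ends e := by
    refine Eq.trans ?_ (congrArg (Sym2.map P) (Quot.out_eq e.1))
    change _ = s(P (Quot.out e.1).1, P (Quot.out e.1).2)
    simp
  curve_avoids e t v h := by
    have hadj : G.Adj (Quot.out e.1).1 (Quot.out e.1).2 := by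
      rw [← SimpleGraph.mem_edgeSet]
      have : s((Quot.out e.1).1, (Quot.out e.1).2) = e.1 := Quot.out_eq e.1
      rw [this]; exact e.2
    set a := (Quot.out e.1).1
    set b := (Quot.out e.1).2
    have hab : P a ≠ P b := hP.ne hadj.ne
    change AffineMap.lineMap (P a) (P b) (t : ℝ) = P v at h
    by_cases hva : v = a
    · left
      rw [hva] at h
      have := lineMap_injective_real hab (h.trans (AffineMap.lineMap_apply_zero (P a) (P b)).symm)
      exact Subtype.ext this
    by_cases hvb : v = b
    · right
      rw [hvb] at h
      have := lineMap_injective_real hab (h.trans (AffineMap.lineMap_apply_one (P a) (P b)).symm)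
      exact Subtype.ext this
    · refine absurd ?_ (hG a b v hadj hva hvb)
      rw [← h]
      simp only [orient, AffineMap.lineMap_apply, vsub_eq_sub, vadd_eq_add, Prod.fst_add,
        Prod.snd_add, Prod.smul_fst, Prod.smul_snd, Prod.fst_sub, Prod.snd_sub, smul_eq_mul]
      ring

variable (hP : Function.Injective P) (hG : EdgesInGeneralPosition G P)

theorem inner_straightLineDrawing (e : G.edgeSet) :
    (straightLineDrawing hP hG).inner e = openSegmentOf P e.1 := by
  have : openSegmentOf P e.1 = openSegment ℝ (P (Quot.out e.1).1) (P (Quot.out e.1).2) := by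
    conv_lhs => rw [← Quot.out_eq e.1]
    rfl
  rw [this, openSegment_eq_image_lineMap]
  ext p
  constructor
  · rintro ⟨t, ⟨h0, h1⟩, rfl⟩
    exact ⟨t, ⟨h0, h1⟩, rfl⟩
  · rintro ⟨t, ⟨h0, h1⟩, rfl⟩
    exact ⟨⟨t, h0.le, h1.le⟩, ⟨h0, h1⟩, rfl⟩

theorem disjoint_openSegmentOf_of_common {e f : Sym2 V} (hG : EdgesInGeneralPosition G P)
    (he : e ∈ G.edgeSet) (hf : f ∈ G.edgeSet) (hef : e ≠ f) {v : V} (hve : v ∈ e) (hvf : v ∈ f) :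
    Disjoint (openSegmentOf P e) (openSegmentOf P f) := by
  obtain ⟨a, rfl⟩ := Sym2.mem_iff_exists.1 hve
  obtain ⟨b, rfl⟩ := Sym2.mem_iff_exists.1 hvf
  refine disjoint_openSegment_of_orient_ne_zero (hG v a b he (SimpleGraph.Adj.ne hf).symm ?_)
  rintro rfl
  exact hef rfl

/-- General position yields every condition of a good drawing except the absence of triple points,
which is therefore a hypothesis. -/
theorem isGood_straightLineDrawing
    (h3 : ∀ e ∈ G.edgeSet, ∀ f ∈ G.edgeSet, ∀ g ∈ G.edgeSet, e ≠ f → f ≠ g → e ≠ g →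
      openSegmentOf P e ∩ openSegmentOf P f ∩ openSegmentOf P g = ∅) :
    (straightLineDrawing hP hG).IsGood := by
  -- Edges that meet have no common end, so the ends of one are off the line of the other.
  have ends : ∀ e f : Sym2 V, e ∈ G.edgeSet → f ∈ G.edgeSet → e ≠ f →
      (openSegmentOf P e ∩ openSegmentOf P f).Nonempty →
      ∃ a b c d, e = s(a, b) ∧ f = s(c, d) ∧ orient (P a) (P b) (P c) ≠ 0 ∧
        orient (P c) (P d) (P a) ≠ 0 := by
    intro e f he hf hef ⟨p, hp⟩
    have hdis : ∀ v, v ∈ e → v ∈ f → False := fun v hv hv' =>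
      Set.disjoint_left.1 (disjoint_openSegmentOf_of_common hG he hf hef hv hv') hp.1 hp.2
    induction e with | _ a b
    induction f with | _ c d
    simp only [Sym2.mem_iff] at hdis
    refine ⟨a, b, c, d, rfl, rfl, hG a b c he ?_ ?_, hG c d a hf ?_ ?_⟩ <;> rintro rfl
    · exact hdis c (.inl rfl) (.inl rfl)
    · exact hdis c (.inr rfl) (.inl rfl)
    · exact hdis a (.inl rfl) (.inl rfl)
    · exact hdis a (.inl rfl) (.inr rfl)
  refine ⟨fun e => ?_, fun e f hef ⟨v, hve, hvf⟩ => ?_, fun e f hef => ?_, fun e f hef p hp => ?_,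
    fun e f g hef hfg heg => ?_⟩
  · have hadj : G.Adj (Quot.out e.1).1 (Quot.out e.1).2 := by
      rw [← SimpleGraph.mem_edgeSet]
      have : s((Quot.out e.1).1, (Quot.out e.1).2) = e.1 := Quot.out_eq e.1
      rw [this]; exact e.2
    exact (lineMap_injective_real (hP.ne hadj.ne)).comp Subtype.val_injective
  · rw [inner_straightLineDrawing, inner_straightLineDrawing]
    exact disjoint_openSegmentOf_of_common hG e.2 f.2 (Subtype.coe_injective.ne hef) hve hvf
  · rw [inner_straightLineDrawing, inner_straightLineDrawing]
    intro p hp q hq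
    obtain ⟨a, b, c, d, h1, h2, hc, -⟩ := ends e f e.2 f.2 (Subtype.coe_injective.ne hef) ⟨p, hp⟩
    rw [h1, h2] at hp hq
    exact openSegment_inter_subsingleton hc hp hq
  · rw [inner_straightLineDrawing, inner_straightLineDrawing] at *
    obtain ⟨a, b, c, d, h1, h2, hc, ha⟩ := ends e f e.2 f.2 (Subtype.coe_injective.ne hef) ⟨p, hp⟩
    rw [h1, h2] at hp ⊢
    exact crossProperlyAt_of_mem hc ha hp.1 hp.2
  · simp only [inner_straightLineDrawing]
    exact h3 _ e.2 _ f.2 _ g.2 (Subtype.coe_injective.ne hef) (Subtype.coe_injective.ne hfg)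
      (Subtype.coe_injective.ne heg)

/-- Two edges have at most one common inner point, so a crossing can be identified with its pair of
edges. -/
theorem crossings_straightLineDrawing (hgood : (straightLineDrawing hP hG).IsGood) :
    (straightLineDrawing hP hG).crossings =
      {z : Sym2 (Sym2 V) | ∃ e ∈ G.edgeSet, ∃ f ∈ G.edgeSet, e ≠ f ∧ z = s(e, f) ∧
        (openSegmentOf P e ∩ openSegmentOf P f).Nonempty}.encard := by
  have hinj : Set.InjOn (fun c : Sym2 G.edgeSet × (ℝ × ℝ) => c.1.map Subtype.val)
      {c | ∃ e f : G.edgeSet, e ≠ f ∧ c.1 = s(e, f) ∧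
        c.2 ∈ (straightLineDrawing hP hG).inner e ∩ (straightLineDrawing hP hG).inner f} := by
    rintro ⟨z, p⟩ ⟨e, f, hef, rfl, hp⟩ ⟨z', q⟩ ⟨e', f', -, rfl, hq⟩ h
    have h' : s(e, f) = s(e', f') := Sym2.map.injective Subtype.val_injective h
    have hq' : q ∈ (straightLineDrawing hP hG).inner e ∩ (straightLineDrawing hP hG).inner f := by
      rcases Sym2.eq_iff.1 h' with ⟨rfl, rfl⟩ | ⟨rfl, rfl⟩
      exacts [hq, hq.symm]
    exact Prod.ext h' (hgood.once e f hef hp hq')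
  rw [PlaneDrawing.crossings, ← hinj.encard_image]
  congr 1
  ext z
  simp only [inner_straightLineDrawing]
  constructor
  · rintro ⟨⟨z, p⟩, ⟨e, f, hef, rfl, hp⟩, rfl⟩
    exact ⟨e, e.2, f, f.2, Subtype.coe_injective.ne hef, rfl, p, hp⟩
  · rintro ⟨e, he, f, hf, hef, rfl, p, hp⟩
    exact ⟨(s(⟨e, he⟩, ⟨f, hf⟩), p), ⟨⟨e, he⟩, ⟨f, hf⟩, fun h => hef (congrArg Subtype.val h), rfl, hp⟩, rfl⟩

end StraightLineDrawing

/-! ### Vertex codes and the edge list of the augmented cube -/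

/-- The number with binary expansion `a 0, a 1, …`, leading bit first. -/
def vertexCode : (n : ℕ) → (Fin n → Bool) → ℕ
  | 0, _ => 0
  | n + 1, a => vertexCode n (Fin.tail a) + bif a 0 then 2 ^ n else 0

theorem vertexCode_lt : ∀ (n : ℕ) (a : Fin n → Bool), vertexCode n a < 2 ^ n
  | 0, _ => by simp [vertexCode]
  | n + 1, a => by
    have := vertexCode_lt n (Fin.tail a)
    rw [vertexCode, pow_succ]
    cases a 0 <;> simp <;> omega

theorem vertexCode_injective : ∀ n : ℕ, Function.Injective (vertexCode n)
  | 0 => fun _ _ _ => Subsingleton.elim _ _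
  | n + 1 => fun a b h => by
    have ha := vertexCode_lt n (Fin.tail a)
    have hb := vertexCode_lt n (Fin.tail b)
    simp only [vertexCode] at h
    have h0 : a 0 = b 0 := by
      cases h1 : a 0 <;> cases h2 : b 0 <;> simp [h1, h2] at h ⊢ <;> omega
    rw [h0] at h
    have ht := vertexCode_injective n (Nat.add_right_cancel h)
    rw [← Fin.cons_self_tail a, ← Fin.cons_self_tail b, h0, ht]

theorem exists_vertexCode_eq : ∀ (n k : ℕ), k < 2 ^ n → ∃ a, vertexCode n a = k
  | 0, k, hk => ⟨fun i => i.elim0, by simp [vertexCode]; simp at hk; exact hk.symm⟩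
  | n + 1, k, hk => by
    rw [pow_succ] at hk
    by_cases h : k < 2 ^ n
    · obtain ⟨a, ha⟩ := exists_vertexCode_eq n k h
      exact ⟨Fin.cons false a, by simp [vertexCode, ha]⟩
    · obtain ⟨a, ha⟩ := exists_vertexCode_eq n (k - 2 ^ n) (by omega)
      exact ⟨Fin.cons true a, by simp [vertexCode, ha]; omega⟩

/-- Complementary strings add up to the string of ones, without carries. -/
theorem vertexCode_compl : ∀ (n : ℕ) (a b : Fin n → Bool),
    (∀ i, a i = !b i) ↔ vertexCode n a + vertexCode n b + 1 = 2 ^ n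
  | 0, a, b => by simp [vertexCode]
  | n + 1, a, b => by
    have ha := vertexCode_lt n (Fin.tail a)
    have hb := vertexCode_lt n (Fin.tail b)
    have ih := vertexCode_compl n (Fin.tail a) (Fin.tail b)
    have ht : (∀ i, a i = !b i) ↔ a 0 = (!b 0) ∧ ∀ i, Fin.tail a i = !Fin.tail b i := by
      rw [Fin.forall_fin_succ]; rfl
    rw [ht, ih, vertexCode, vertexCode, pow_succ]
    cases a 0 <;> cases b 0 <;> simp <;> omega

/-- The edges of the augmented cube as pairs of vertex codes, the smaller code first. -/
def cubeEdges : ℕ → List (ℕ × ℕ)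
  | 0 => []
  | 1 => [(0, 1)]
  | n + 2 =>
    cubeEdges (n + 1) ++
      (cubeEdges (n + 1)).map (fun p => (p.1 + 2 ^ (n + 1), p.2 + 2 ^ (n + 1))) ++
      (List.range (2 ^ (n + 1))).map (fun i => (i, i + 2 ^ (n + 1))) ++
      (List.range (2 ^ (n + 1))).map (fun i => (i, 2 ^ (n + 1) - 1 - i + 2 ^ (n + 1)))

theorem mem_cubeEdges_succ {n : ℕ} {p : ℕ × ℕ} : p ∈ cubeEdges (n + 2) ↔
    p ∈ cubeEdges (n + 1) ∨
    (2 ^ (n + 1) ≤ p.1 ∧ 2 ^ (n + 1) ≤ p.2 ∧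
      (p.1 - 2 ^ (n + 1), p.2 - 2 ^ (n + 1)) ∈ cubeEdges (n + 1)) ∨
    (p.1 < 2 ^ (n + 1) ∧ p.2 = p.1 + 2 ^ (n + 1)) ∨
    (p.1 < 2 ^ (n + 1) ∧ p.1 + p.2 + 1 = 2 ^ (n + 2)) := by
  obtain ⟨u, v⟩ := p
  simp only [cubeEdges, List.mem_append, List.mem_map, List.mem_range, Prod.exists, Prod.mk.injEq,
    or_assoc]
  refine or_congr Iff.rfl (or_congr ?_ (or_congr ?_ ?_))
  · constructor
    · rintro ⟨a, b, h, rfl, rfl⟩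
      simpa using h
    · rintro ⟨h1, h2, h3⟩
      exact ⟨_, _, h3, by omega, by omega⟩
  · constructor
    · rintro ⟨a, h, rfl, rfl⟩
      exact ⟨h, rfl⟩
    · rintro ⟨h, h'⟩
      exact ⟨u, h, rfl, h'.symm⟩
  · rw [pow_succ 2 (n + 1)]
    constructor
    · rintro ⟨a, h, rfl, rfl⟩
      omega
    · rintro ⟨h, h'⟩
      exact ⟨u, h, rfl, by omega⟩

theorem cubeEdges_lt : ∀ (n : ℕ), ∀ p ∈ cubeEdges n, p.1 < p.2 ∧ p.2 < 2 ^ n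
  | 0 => by simp [cubeEdges]
  | 1 => by simp [cubeEdges]
  | n + 2 => fun p hp => by
    have ih := cubeEdges_lt (n + 1)
    have hpow : 2 ^ (n + 2) = 2 ^ (n + 1) * 2 := pow_succ 2 (n + 1)
    rcases mem_cubeEdges_succ.1 hp with h | ⟨h1, h2, h⟩ | h | h
    · have := ih p h; omega
    · have := ih _ h; simp only at this; omega
    · omega
    · omega

theorem nodup_cubeEdges : ∀ n : ℕ, (cubeEdges n).Nodup
  | 0 => by simp [cubeEdges]
  | 1 => by simp [cubeEdges]
  | n + 2 => by
    have hlt := cubeEdges_lt (n + 1)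
    have hpow : 2 ^ (n + 2) = 2 ^ (n + 1) * 2 := pow_succ 2 (n + 1)
    have h2 : 2 ≤ 2 ^ (n + 1) := by
      calc 2 = 2 ^ 1 := rfl
        _ ≤ _ := Nat.pow_le_pow_right (by norm_num) (by omega)
    rw [cubeEdges]
    simp only [List.nodup_append', List.disjoint_left, List.mem_append, List.mem_map, List.mem_range]
    refine ⟨⟨⟨nodup_cubeEdges (n + 1), (nodup_cubeEdges (n + 1)).map ?_, ?_⟩,
      List.nodup_range.map ?_, ?_⟩, List.nodup_range.map ?_, ?_⟩
    · intro p q h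
      simp only [Prod.mk.injEq] at h
      ext <;> omega
    · rintro p hp ⟨q, hq, rfl⟩
      have h1 := hlt _ hp; have h2 := hlt _ hq; simp only at h1; omega
    · intro p q h
      simpa using h
    · rintro p (hp | ⟨q, hq, rfl⟩) ⟨i, hi, h⟩
      · have := hlt _ hp; rw [← h] at this; simp only at this; omega
      · have := hlt _ hq; simp only [Prod.mk.injEq] at h; omega
    · intro p q h
      simp only [Prod.mk.injEq] at h
      exact h.1
    · rintro p ((hp | ⟨q, hq, rfl⟩) | ⟨i, hi, rfl⟩) ⟨j, hj, h⟩
      · have := hlt _ hp; rw [← h] at this; simp only at this; omega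
      · have := hlt _ hq; simp only [Prod.mk.injEq] at h; omega
      · simp only [Prod.mk.injEq] at h
        -- The two matchings have no common edge: this would require `2 * i + 1 = 2 ^ (n + 1)`,
        -- against parity.
        have : 2 ^ (n + 1) = 2 * 2 ^ n := by rw [pow_succ]; ring
        omega

theorem augmentedCube_adj_iff : ∀ (n : ℕ) (a b : Fin n → Bool), (augmentedCube n).Adj a b ↔
    (vertexCode n a, vertexCode n b) ∈ cubeEdges n ∨ (vertexCode n b, vertexCode n a) ∈ cubeEdges n
  | 0, a, b => by simp [augmentedCube, cubeEdges]
  | 1, a, b => by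
    have h : a = b ↔ vertexCode 1 a = vertexCode 1 b := (vertexCode_injective 1).eq_iff.symm
    have ha := vertexCode_lt 1 a
    have hb := vertexCode_lt 1 b
    simp only [augmentedCube, SimpleGraph.top_adj, cubeEdges, List.mem_singleton, Prod.mk.injEq,
      ne_eq, h]
    omega
  | n + 2, a, b => by
    have ih := augmentedCube_adj_iff (n + 1) (Fin.tail a) (Fin.tail b)
    have hlt := cubeEdges_lt (n + 1)
    have ha := vertexCode_lt (n + 1) (Fin.tail a)
    have hb := vertexCode_lt (n + 1) (Fin.tail b)
    have heq : (∀ i, Fin.tail a i = Fin.tail b i) ↔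
        vertexCode (n + 1) (Fin.tail a) = vertexCode (n + 1) (Fin.tail b) := by
      rw [← funext_iff, (vertexCode_injective _).eq_iff]
    have hc := vertexCode_compl (n + 1) (Fin.tail a) (Fin.tail b)
    have hpow : 2 ^ (n + 2) = 2 ^ (n + 1) * 2 := pow_succ 2 (n + 1)
    have hno : ∀ u v : ℕ, 2 ^ (n + 1) ≤ u ∨ 2 ^ (n + 1) ≤ v → (u, v) ∉ cubeEdges (n + 1) := by
      intro u v h h'
      have := hlt _ h'; simp only at this; omega
    have hadj : (augmentedCube (n + 2)).Adj a b ↔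
        (a 0 = b 0 ∧ (augmentedCube (n + 1)).Adj (Fin.tail a) (Fin.tail b)) ∨
        (a 0 ≠ b 0 ∧
          ((∀ i, Fin.tail a i = Fin.tail b i) ∨ (∀ i, Fin.tail a i = !(Fin.tail b i)))) := Iff.rfl
    have hva : vertexCode (n + 2) a =
        vertexCode (n + 1) (Fin.tail a) + bif a 0 then 2 ^ (n + 1) else 0 := rfl
    have hvb : vertexCode (n + 2) b =
        vertexCode (n + 1) (Fin.tail b) + bif b 0 then 2 ^ (n + 1) else 0 := rfl
    rw [hadj, ih, heq, hc, mem_cubeEdges_succ, mem_cubeEdges_succ, hva, hvb]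
    clear hva hvb hadj heq hc ih
    generalize vertexCode (n + 1) (Fin.tail a) = x at *
    generalize vertexCode (n + 1) (Fin.tail b) = y at *
    -- Equal leading bits leave only the clause of one copy, different ones only the two matchings.
    cases a 0 <;> cases b 0
    · have h1 : ¬ 2 ^ (n + 1) ≤ x := by omega
      have h2 : y ≠ x + 2 ^ (n + 1) := by omega
      have h3 : x ≠ y + 2 ^ (n + 1) := by omega
      have h4 : x + y + 1 ≠ 2 ^ (n + 2) := by omega
      have h5 : y + x + 1 ≠ 2 ^ (n + 2) := by omega
      simp [h1, h2, h3, h4, h5, Nat.not_le.2 hb]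
    · simp [hno]
      omega
    · simp [hno]
      omega
    · simp [hno]

/-! Arithmetic on lists of numbers that are packed into the 40-bit lanes of one number. -/

/-- `force x k` is `k x`; the recursion on `x` makes the kernel evaluate `x` first. -/
def force {α : Type} (x : ℕ) (k : ℕ → α) : α :=
  Nat.rec (motive := fun _ => α) (k Nat.zero) (fun m _ => k (Nat.succ m)) x

@[simp]
theorem force_eq {α : Type} (x : ℕ) (k : ℕ → α) : force x k = k x := by
  cases x <;> rfl

/-- The values of `g` on a list, in lanes of 40 bits, the first one in the lowest lane. -/
def pack {α : Type} (g : α → ℕ) : List α → ℕ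
  | [] => 0
  | a :: l => g a + 2 ^ 40 * pack g l

/-- The `i`-th lane. -/
def lane (X i : ℕ) : ℕ := Nat.mod (Nat.shiftRight X (Nat.mul 40 i)) (Nat.pow 2 40)

theorem lane_eq (X i : ℕ) : lane X i = (X >>> (40 * i)) % 2 ^ 40 := rfl

theorem natBeq_eq_false {a b : ℕ} (h : a ≠ b) : Nat.beq a b = false := by
  cases h' : Nat.beq a b
  · rfl
  · exact absurd (Nat.eq_of_beq_eq_true h') h

section Lanes

variable {α : Type} {g h : α → ℕ}

theorem pack_add (g h : α → ℕ) (l : List α) : pack (fun a => g a + h a) l = pack g l + pack h l := by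
  induction l with
  | nil => rfl
  | cons a l ih => simp only [pack, ih]; ring

theorem pack_mul (c : ℕ) (g : α → ℕ) (l : List α) : pack (fun a => c * g a) l = c * pack g l := by
  induction l with
  | nil => rfl
  | cons a l ih => simp only [pack, ih]; ring

theorem pack_const (c : ℕ) (l : List α) : pack (fun _ => c) l = c * pack (fun _ => 1) l := by
  rw [← pack_mul]; simp

theorem testBit_add_two_pow_mul {a : ℕ} (b : ℕ) (ha : a < 2 ^ 40) (i : ℕ) :
    (a + 2 ^ 40 * b).testBit i = if i < 40 then a.testBit i else b.testBit (i - 40) := by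
  rw [add_comm, Nat.testBit_two_pow_mul_add b ha]

theorem and_add_two_pow_mul {a c : ℕ} (b d : ℕ) (ha : a < 2 ^ 40) (hc : c < 2 ^ 40) :
    (a + 2 ^ 40 * b) &&& (c + 2 ^ 40 * d) = (a &&& c) + 2 ^ 40 * (b &&& d) := by
  refine Nat.eq_of_testBit_eq fun i => ?_
  rw [Nat.testBit_and, testBit_add_two_pow_mul b ha, testBit_add_two_pow_mul d hc,
    testBit_add_two_pow_mul _ (Nat.and_lt_two_pow a hc)]
  split <;> simp

theorem xor_add_two_pow_mul {a c : ℕ} (b d : ℕ) (ha : a < 2 ^ 40) (hc : c < 2 ^ 40) :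
    (a + 2 ^ 40 * b) ^^^ (c + 2 ^ 40 * d) = (a ^^^ c) + 2 ^ 40 * (b ^^^ d) := by
  refine Nat.eq_of_testBit_eq fun i => ?_
  rw [Nat.testBit_xor, testBit_add_two_pow_mul b ha, testBit_add_two_pow_mul d hc,
    testBit_add_two_pow_mul _ (Nat.xor_lt_two_pow ha hc)]
  split <;> simp

theorem lane_zero_add {a : ℕ} (b : ℕ) (ha : a < 2 ^ 40) : lane (a + 2 ^ 40 * b) 0 = a := by
  rw [lane_eq]
  simp only [mul_zero, Nat.shiftRight_zero, Nat.add_mul_mod_self_left]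
  exact Nat.mod_eq_of_lt ha

theorem lane_succ_add {a : ℕ} (b : ℕ) (ha : a < 2 ^ 40) (i : ℕ) :
    lane (a + 2 ^ 40 * b) (i + 1) = lane b i := by
  rw [lane_eq, lane_eq, mul_add, mul_one, add_comm (40 * i), Nat.shiftRight_add,
    Nat.shiftRight_eq_div_pow _ 40, Nat.add_mul_div_left _ _ (by positivity), Nat.div_eq_of_lt ha,
    zero_add]

theorem lane_pack {l : List α} (hg : ∀ a ∈ l, g a < 2 ^ 40) (i : ℕ) :
    lane (pack g l) i = (l.map g).getD i 0 := by
  induction l generalizing i with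
  | nil => simp [pack, lane_eq]
  | cons a l ih =>
    have ha := hg a (by simp)
    cases i with
    | zero => exact lane_zero_add _ ha
    | succ i =>
      rw [pack, lane_succ_add _ ha, ih fun b hb => hg b (by simp [hb])]
      simp

/-- The lane of `signs B p q`, where `B` has `2 ^ 39` in every lane, is `2 ^ 39` where the lane of
`q` is at most that of `p`, and `0` elsewhere. -/
def signs (B p q : ℕ) : ℕ := (p + B - q) &&& B

/-- For numbers below `2 ^ 39`, bit 39 of `p + 2 ^ 39 - q` is set exactly if `q ≤ p`. The added `2 ^
39` also prevents borrowing from the next lane. -/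
theorem signs_pack {p q : α → ℕ} {l : List α} (hp : ∀ a ∈ l, p a < 2 ^ 39)
    (hq : ∀ a ∈ l, q a < 2 ^ 39) :
    signs (2 ^ 39 * pack (fun _ => 1) l) (pack p l) (pack q l) =
      pack (fun a => bif Nat.ble (q a) (p a) then 2 ^ 39 else 0) l := by
  -- The inequality is carried through the induction because the truncated subtraction splits into
  -- lanes only if the higher lanes do not underflow.
  suffices H : pack q l ≤ pack p l + 2 ^ 39 * pack (fun _ => 1) l ∧
      signs (2 ^ 39 * pack (fun _ => 1) l) (pack p l) (pack q l) =
      pack (fun a => bif Nat.ble (q a) (p a) then 2 ^ 39 else 0) l from H.2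
  induction l with
  | nil => simp [pack, signs]
  | cons a l ih =>
    obtain ⟨ih1, ih2⟩ := ih (fun b hb => hp b (by simp [hb])) fun b hb => hq b (by simp [hb])
    have hpa := hp a (by simp)
    have hqa := hq a (by simp)
    have e1 : 2 ^ 39 * pack (fun _ => 1) (a :: l) =
        2 ^ 39 + 2 ^ 40 * (2 ^ 39 * pack (fun _ => 1) l) := by
      rw [pack]; ring
    rw [e1]
    simp only [pack, signs] at ih1 ih2 ⊢
    rw [← ih2]
    generalize pack p l = P at *
    generalize pack q l = Q at *
    generalize 2 ^ 39 * pack (fun _ => 1) l = B at *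
    refine ⟨by omega, ?_⟩
    have e2 : p a + 2 ^ 40 * P + (2 ^ 39 + 2 ^ 40 * B) - (q a + 2 ^ 40 * Q) =
        (p a + 2 ^ 39 - q a) + 2 ^ 40 * (P + B - Q) := by omega
    rw [e2, and_add_two_pow_mul _ _ (by omega) (by norm_num), Nat.and_two_pow]
    congr 1
    rw [Nat.testBit_eq_decide_div_mod_eq]
    cases hle : Nat.ble (q a) (p a)
    · have : ¬ q a ≤ p a := fun h => by rw [Nat.ble_eq_true_of_le h] at hle; cases hle
      rw [Nat.div_eq_of_lt (by omega)]
      simp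
    · have := Nat.le_of_ble_eq_true hle
      have : (p a + 2 ^ 39 - q a) / 2 ^ 39 = 1 := by
        rw [Nat.div_eq_iff (by norm_num)]; omega
      rw [this]
      simp

theorem and_pack_cond (s t : α → Bool) (l : List α) :
    (pack (fun a => bif s a then 2 ^ 39 else 0) l &&& pack (fun a => bif t a then 2 ^ 39 else 0) l) =
      pack (fun a => bif s a && t a then 2 ^ 39 else 0) l := by
  induction l with
  | nil => simp [pack]
  | cons a l ih =>
    simp only [pack]
    rw [and_add_two_pow_mul _ _ (by cases s a <;> norm_num) (by cases t a <;> norm_num), ih]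
    cases s a <;> cases t a <;> simp

theorem xor_pack_cond (s t : α → Bool) (l : List α) :
    (pack (fun a => bif s a then 2 ^ 39 else 0) l ^^^ pack (fun a => bif t a then 2 ^ 39 else 0) l) =
      pack (fun a => bif (s a).xor (t a) then 2 ^ 39 else 0) l := by
  induction l with
  | nil => simp [pack]
  | cons a l ih =>
    simp only [pack]
    rw [xor_add_two_pow_mul _ _ (by cases s a <;> norm_num) (by cases t a <;> norm_num), ih]
    cases s a <;> cases t a <;> simp

/-- The nonzero lanes of `K` among the lanes `off, …, off + 2 ^ d - 1`, in front of `acc`. -/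
def nonzeroLanes (K d : ℕ) : ℕ → List ℕ → List ℕ :=
  Nat.rec (motive := fun _ => ℕ → List ℕ → List ℕ)
    (fun off acc => bif Nat.beq (lane K off) 0 then acc else off :: acc)
    (fun d ih off acc =>
      bif Nat.beq (Nat.mod (Nat.shiftRight K (Nat.mul 40 off)) (Nat.pow 2 (Nat.shiftLeft 80 d))) 0
      then acc
      else force (Nat.add off (Nat.shiftLeft 1 d)) fun off' => ih off (ih off' acc)) d

theorem lane_eq_zero_of_mod_eq_zero {K off s i : ℕ} (h : (K >>> (40 * off)) % 2 ^ (40 * s) = 0)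
    (h1 : off ≤ i) (h2 : i < off + s) : lane K i = 0 := by
  obtain ⟨j, rfl⟩ := Nat.exists_eq_add_of_le h1
  rw [lane_eq, mul_add, Nat.shiftRight_add, Nat.shiftRight_eq_div_pow _ (40 * j)]
  apply Nat.mod_eq_zero_of_dvd
  apply Nat.dvd_div_of_mul_dvd
  rw [← pow_add]
  exact (Nat.pow_dvd_pow 2 (by omega)).trans (Nat.dvd_of_mod_eq_zero h)

/-- The `80 <<< d` bits tested at once are the `2 ^ (d + 1)` lanes of a block, so a skipped block
has no nonzero lane. -/
theorem nonzeroLanes_eq (K d : ℕ) : ∀ (off : ℕ) (acc : List ℕ), nonzeroLanes K d off acc =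
    (List.range' off (2 ^ d)).filter (fun i => lane K i != 0) ++ acc := by
  induction d with
  | zero =>
    intro off acc
    change (bif Nat.beq (lane K off) 0 then acc else off :: acc) = _
    by_cases h : lane K off = 0
    · simp [h]
    · simp [h, natBeq_eq_false h]
  | succ d ih =>
    intro off acc
    change (bif Nat.beq ((K >>> (40 * off)) % 2 ^ (80 <<< d)) 0 then acc
      else force (off + 1 <<< d) fun off' =>
        nonzeroLanes K d off (nonzeroLanes K d off' acc)) = _
    rw [force_eq, ih, ih, Nat.one_shiftLeft]
    have hsplit : List.range' off (2 ^ (d + 1)) =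
        List.range' off (2 ^ d) ++ List.range' (off + 2 ^ d) (2 ^ d) := by
      rw [List.range'_append_1, pow_succ, mul_two]
    by_cases h : (K >>> (40 * off)) % 2 ^ (80 <<< d) = 0
    · have hw : 80 <<< d = 40 * 2 ^ (d + 1) := by rw [Nat.shiftLeft_eq, pow_succ]; ring
      have hnil : (List.range' off (2 ^ (d + 1))).filter (fun i => lane K i != 0) = [] := by
        rw [List.filter_eq_nil_iff]
        intro i hi
        rw [List.mem_range'_1] at hi
        rw [hw] at h
        simp [lane_eq_zero_of_mod_eq_zero h hi.1 hi.2]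
      rw [h, hnil]
      rfl
    · rw [natBeq_eq_false h, cond_false, hsplit, List.filter_append, List.append_assoc]

theorem map_filter_range_lane {l : List α} (hg : ∀ a ∈ l, g a < 2 ^ 40) (z : α) {n : ℕ}
    (hn : l.length ≤ n) :
    ((List.range n).filter (fun i => lane (pack g l) i != 0)).map (fun i => l.getD i z) =
      l.filter (fun a => g a != 0) := by
  induction l generalizing n with
  | nil => simp [pack, lane_eq]
  | cons a l ih =>
    obtain ⟨n, rfl⟩ : ∃ m, n = m + 1 := ⟨n - 1, by simp at hn; omega⟩
    have ha := hg a (by simp)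
    have hl := ih (n := n) (fun b hb => hg b (by simp [hb])) (by simpa using hn)
    rw [List.range_succ_eq_map, List.filter_cons, List.filter_map, pack, lane_zero_add _ ha,
      List.filter_cons, ← hl]
    have : ((fun i => lane (g a + 2 ^ 40 * pack g l) i != 0) ∘ Nat.succ) =
        fun i => lane (pack g l) i != 0 := by
      funext i
      rw [Function.comp_apply, Nat.succ_eq_add_one, lane_succ_add _ ha]
    rw [this]
    split <;> simp

/-- Lane `0` is reserved for the label `a`. The search starts at lane `1`, and `Nat.pred` turns
lanes into positions of the list. -/
theorem map_nonzeroLanes {l : List α} (hg : ∀ a ∈ l, g a < 2 ^ 40) (z : α) {d a : ℕ}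
    (ha : a < 2 ^ 40) (hn : l.length ≤ 2 ^ d) :
    (nonzeroLanes (2 ^ 40 * pack g l + a) d 1 []).map (fun i => l.getD (Nat.pred i) z) =
      l.filter (fun a => g a != 0) := by
  rw [nonzeroLanes_eq, List.append_nil, List.range'_eq_map_range, List.filter_map, List.map_map,
    ← map_filter_range_lane hg z hn, add_comm]
  have : ((fun i => lane (a + 2 ^ 40 * pack g l) i != 0) ∘ fun x => 1 + x) =
      fun i => lane (pack g l) i != 0 := by
    funext i
    simp only [Function.comp_apply, add_comm 1 i, lane_succ_add _ ha]
  rw [this]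
  congr 1
  funext i
  simp [add_comm 1 i]

end Lanes

/-! A checker for straight-line drawings on a grid, in a form that the kernel evaluates quickly. -/

/-- A segment from `(x₁, y₁)` to `(x₂, y₂)`, with the numbers of its two ends. -/
structure GridSegment where
  /-- number of the first end -/
  u : ℕ
  /-- number of the second end -/
  v : ℕ
  /-- abscissa of the first end -/
  x₁ : ℕ
  /-- ordinate of the first end -/
  y₁ : ℕ
  /-- abscissa of the second end -/
  x₂ : ℕ
  /-- ordinate of the second end -/
  y₂ : ℕ

/-- The bilinear form in which both sides of the orientation test are written. -/
def lin (a b c X Y : ℕ) : ℕ := Nat.add (Nat.add (Nat.mul a X) (Nat.mul b Y)) c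

theorem lin_eq (a b c X Y : ℕ) : lin a b c X Y = a * X + b * Y + c := rfl

theorem lin_pack {α : Type} (a b : ℕ) (f g h : α → ℕ) (l : List α) :
    lin a b (pack h l) (pack f l) (pack g l) = pack (fun i => lin a b (h i) (f i) (g i)) l := by
  simp only [lin_eq, pack_add, pack_mul]

namespace GridSegment

/-- The positive terms of the orientation of the ends of `e` and the point `(x, y)`. -/
def pos (e : GridSegment) (x y : ℕ) : ℕ := lin e.y₁ e.x₂ (Nat.mul e.x₁ e.y₂) x y

/-- The negative terms of the orientation of the ends of `e` and the point `(x, y)`. -/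
def neg (e : GridSegment) (x y : ℕ) : ℕ := lin e.y₂ e.x₁ (Nat.mul e.y₁ e.x₂) x y

/-- Whether `(x, y)` is to the left of the line through `e`, or on it. -/
def left (e : GridSegment) (x y : ℕ) : Bool := Nat.ble (e.neg x y) (e.pos x y)

/-- Whether the ends of `f` are on different sides of the line through `e`. -/
def separates (e f : GridSegment) : Bool := (e.left f.x₁ f.y₁).xor (e.left f.x₂ f.y₂)

/-- Whether `e` and `f` have a common end. -/
def meets (e f : GridSegment) : Bool :=
  bif Nat.beq e.u f.u then true else bif Nat.beq e.u f.v then true else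
  bif Nat.beq e.v f.u then true else Nat.beq e.v f.v

theorem meets_iff {e f : GridSegment} :
    e.meets f = true ↔ e.u = f.u ∨ e.u = f.v ∨ e.v = f.u ∨ e.v = f.v := by
  simp [meets, Bool.cond_eq_ite, Nat.beq_eq]

/-- Whether `e` and `f` cross. -/
def crosses (e f : GridSegment) : Bool := (f.separates e && e.separates f) && !e.meets f

/-- Twice the area of the triangle formed by the ends of `f` and `(x, y)`. -/
def area (f : GridSegment) (x y : ℕ) : ℕ :=
  Nat.add (Nat.sub (f.pos x y) (f.neg x y)) (Nat.sub (f.neg x y) (f.pos x y))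

/-- The ratio of these two areas determines where the line through `f` meets `e`. -/
def ratio (e f : GridSegment) : ℕ × ℕ := (f.area e.x₁ e.y₁, f.area e.x₂ e.y₂)

/-- All numbers are so small that orientations fit into 40-bit lanes. -/
structure Small (e : GridSegment) : Prop where
  u : e.u < 2 ^ 18
  v : e.v < 2 ^ 18
  x₁ : e.x₁ < 2 ^ 18
  y₁ : e.y₁ < 2 ^ 18
  x₂ : e.x₂ < 2 ^ 18
  y₂ : e.y₂ < 2 ^ 18

/-- Three products below `2 ^ 36` leave bit 39 of a lane free for the sign. -/
theorem lin_lt {a b c d x y : ℕ} (ha : a < 2 ^ 18) (hb : b < 2 ^ 18) (hc : c < 2 ^ 18)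
    (hd : d < 2 ^ 18) (hx : x < 2 ^ 18) (hy : y < 2 ^ 18) : lin a b (c * d) x y < 2 ^ 39 := by
  have h1 := Nat.mul_lt_mul'' ha hx
  have h2 := Nat.mul_lt_mul'' hb hy
  have h3 := Nat.mul_lt_mul'' hc hd
  rw [lin_eq]
  omega

theorem Small.pos_lt {e : GridSegment} (he : e.Small) {x y : ℕ} (hx : x < 2 ^ 18)
    (hy : y < 2 ^ 18) : e.pos x y < 2 ^ 39 := lin_lt he.y₁ he.x₂ he.x₁ he.y₂ hx hy

theorem Small.neg_lt {e : GridSegment} (he : e.Small) {x y : ℕ} (hx : x < 2 ^ 18)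
    (hy : y < 2 ^ 18) : e.neg x y < 2 ^ 39 := lin_lt he.y₂ he.x₁ he.y₁ he.x₂ hx hy

/-- `k` applied to the segment with the given data, which are evaluated first. -/
def force {α : Type} (u v x₁ y₁ x₂ y₂ : ℕ) (k : GridSegment → α) : α :=
  _root_.force u fun u => _root_.force v fun v => _root_.force x₁ fun x₁ =>
  _root_.force y₁ fun y₁ => _root_.force x₂ fun x₂ => _root_.force y₂ fun y₂ =>
  k ⟨u, v, x₁, y₁, x₂, y₂⟩

@[simp]
theorem force_eq {α : Type} (u v x₁ y₁ x₂ y₂ : ℕ) (k : GridSegment → α) :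
    force u v x₁ y₁ x₂ y₂ k = k ⟨u, v, x₁, y₁, x₂, y₂⟩ := by
  simp [force]

end GridSegment

/-- A list of segments, packed. -/
structure PackedSegments where
  /-- numbers of the first ends -/
  u : ℕ
  /-- numbers of the second ends -/
  v : ℕ
  /-- abscissas of the first ends -/
  x₁ : ℕ
  /-- ordinates of the first ends -/
  y₁ : ℕ
  /-- abscissas of the second ends -/
  x₂ : ℕ
  /-- ordinates of the second ends -/
  y₂ : ℕ
  /-- constant terms of `GridSegment.pos` -/
  pos : ℕ
  /-- constant terms of `GridSegment.neg` -/
  neg : ℕ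
  /-- the number `1` in every lane -/
  one : ℕ

namespace PackedSegments

/-- The packed form of a list. -/
def ofList (l : List GridSegment) : PackedSegments where
  u := pack GridSegment.u l
  v := pack GridSegment.v l
  x₁ := pack GridSegment.x₁ l
  y₁ := pack GridSegment.y₁ l
  x₂ := pack GridSegment.x₂ l
  y₂ := pack GridSegment.y₂ l
  pos := pack (fun f => f.x₁ * f.y₂) l
  neg := pack (fun f => f.y₁ * f.x₂) l
  one := pack (fun _ => 1) l

/-- `k` applied to `T` with `e` added in the lowest lanes, evaluated first. -/
def cons {α : Type} (T : PackedSegments) (e : GridSegment) (k : PackedSegments → α) : α :=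
  force (e.u + 2 ^ 40 * T.u) fun u => force (e.v + 2 ^ 40 * T.v) fun v =>
  force (e.x₁ + 2 ^ 40 * T.x₁) fun x₁ => force (e.y₁ + 2 ^ 40 * T.y₁) fun y₁ =>
  force (e.x₂ + 2 ^ 40 * T.x₂) fun x₂ => force (e.y₂ + 2 ^ 40 * T.y₂) fun y₂ =>
  force (e.x₁ * e.y₂ + 2 ^ 40 * T.pos) fun pos => force (e.y₁ * e.x₂ + 2 ^ 40 * T.neg) fun neg =>
  force (1 + 2 ^ 40 * T.one) fun one => k ⟨u, v, x₁, y₁, x₂, y₂, pos, neg, one⟩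

theorem cons_ofList {α : Type} (l : List GridSegment) (e : GridSegment) (k : PackedSegments → α) :
    (ofList l).cons e k = k (ofList (e :: l)) := by
  simp only [cons, force_eq]
  rfl

/-- A number with nonzero lanes for the segments of `T` that `e` separates and that separate `e`. -/
def crossMask (T : PackedSegments) (e : GridSegment) : ℕ :=
  force (2 ^ 39 * T.one) fun B =>
  (signs B (lin e.x₁ e.y₁ T.pos T.y₁ T.x₂) (lin e.x₁ e.y₁ T.neg T.y₂ T.x₁) ^^^
    signs B (lin e.x₂ e.y₂ T.pos T.y₁ T.x₂) (lin e.x₂ e.y₂ T.neg T.y₂ T.x₁)) &&&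
  (signs B (lin e.y₁ e.x₂ (e.x₁ * e.y₂ * T.one) T.x₁ T.y₁)
      (lin e.y₂ e.x₁ (e.y₁ * e.x₂ * T.one) T.x₁ T.y₁) ^^^
    signs B (lin e.y₁ e.x₂ (e.x₁ * e.y₂ * T.one) T.x₂ T.y₂)
      (lin e.y₂ e.x₁ (e.y₁ * e.x₂ * T.one) T.x₂ T.y₂))

theorem crossMask_ofList {l : List GridSegment} (hl : ∀ f ∈ l, f.Small) {e : GridSegment}
    (he : e.Small) : (ofList l).crossMask e =
      pack (fun f => bif f.separates e && e.separates f then 2 ^ 39 else 0) l := by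
  -- One point against the lines of all segments: by bilinearity its coordinates serve as the
  -- coefficients, and the data of the segments as the packed variables.
  have col : ∀ x y, x < 2 ^ 18 → y < 2 ^ 18 → signs (2 ^ 39 * (ofList l).one)
      (lin x y (ofList l).pos (ofList l).y₁ (ofList l).x₂)
      (lin x y (ofList l).neg (ofList l).y₂ (ofList l).x₁) =
      pack (fun f => bif f.left x y then 2 ^ 39 else 0) l := by
    intro x y hx hy
    have h1 : ∀ f : GridSegment, f.pos x y = lin x y (f.x₁ * f.y₂) f.y₁ f.x₂ := fun f => by
      simp only [GridSegment.pos, lin_eq, Nat.mul_eq]; ring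
    have h2 : ∀ f : GridSegment, f.neg x y = lin x y (f.y₁ * f.x₂) f.y₂ f.x₁ := fun f => by
      simp only [GridSegment.neg, lin_eq, Nat.mul_eq]; ring
    simp only [ofList, lin_pack]
    rw [signs_pack]
    · simp only [GridSegment.left, h1, h2]
    · intro f hf
      rw [← h1]; exact (hl f hf).pos_lt hx hy
    · intro f hf
      rw [← h2]; exact (hl f hf).neg_lt hx hy
  -- Packed ends of all segments against the line of `e`; the constant term is repeated in every
  -- lane.
  have row : ∀ x y : GridSegment → ℕ, (∀ f ∈ l, x f < 2 ^ 18) → (∀ f ∈ l, y f < 2 ^ 18) →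
      signs (2 ^ 39 * (ofList l).one)
      (lin e.y₁ e.x₂ (e.x₁ * e.y₂ * (ofList l).one) (pack x l) (pack y l))
      (lin e.y₂ e.x₁ (e.y₁ * e.x₂ * (ofList l).one) (pack x l) (pack y l)) =
      pack (fun f => bif e.left (x f) (y f) then 2 ^ 39 else 0) l := by
    intro x y hx hy
    simp only [ofList, ← pack_const (_ * _), lin_pack]
    rw [signs_pack]
    · rfl
    · exact fun f hf => he.pos_lt (hx f hf) (hy f hf)
    · exact fun f hf => he.neg_lt (hx f hf) (hy f hf)
  have row1 := row GridSegment.x₁ GridSegment.y₁ (fun f hf => (hl f hf).x₁) fun f hf => (hl f hf).y₁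
  have row2 := row GridSegment.x₂ GridSegment.y₂ (fun f hf => (hl f hf).x₂) fun f hf => (hl f hf).y₂
  rw [crossMask, force_eq, col _ _ he.x₁ he.y₁, col _ _ he.x₂ he.y₂]
  change _ &&& (signs _ (lin _ _ _ (pack GridSegment.x₁ l) (pack GridSegment.y₁ l))
    (lin _ _ _ (pack GridSegment.x₁ l) (pack GridSegment.y₁ l)) ^^^
    signs _ (lin _ _ _ (pack GridSegment.x₂ l) (pack GridSegment.y₂ l))
    (lin _ _ _ (pack GridSegment.x₂ l) (pack GridSegment.y₂ l))) = _
  rw [row1, row2, xor_pack_cond, xor_pack_cond, and_pack_cond]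
  rfl

/-- Puts `ratio e f` in front of `acc` for the segments `f` of `T` that have no common end with `e`
and whose numbers are listed, counting from `1`, and applies `k` to the result. -/
def ratios (T : PackedSegments) (e : GridSegment) (k : List (ℕ × ℕ) → Bool) (l : List ℕ) :
    List (ℕ × ℕ) → Bool :=
  List.rec (motive := fun _ => List (ℕ × ℕ) → Bool) k (fun i _ ih acc =>
    force (Nat.pred i) fun i =>
    GridSegment.force (lane T.u i) (lane T.v i) (lane T.x₁ i) (lane T.y₁ i) (lane T.x₂ i)
      (lane T.y₂ i) fun f =>
    bif e.meets f then ih acc else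
      force (f.area e.x₁ e.y₁) fun x => force (f.area e.x₂ e.y₂) fun y => ih ((x, y) :: acc)) l

theorem ratios_ofList {l : List GridSegment} (hl : ∀ f ∈ l, f.Small) (e : GridSegment)
    (k : List (ℕ × ℕ) → Bool) (I : List ℕ) : ∀ acc, (ofList l).ratios e k I acc =
      k ((((I.map fun i => l.getD (Nat.pred i) ⟨0, 0, 0, 0, 0, 0⟩).filter
        (fun f => !e.meets f)).map e.ratio).reverse ++ acc) := by
  induction I with
  | nil => intro acc; rfl
  | cons i I ih =>
    intro acc
    -- Lanes beyond the list are `0`, in agreement with the zero segment as default value.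
    have hget : ∀ g : GridSegment → ℕ, (∀ f : GridSegment, f.Small → g f < 2 ^ 40) →
        g ⟨0, 0, 0, 0, 0, 0⟩ = 0 →
        lane (pack g l) (Nat.pred i) = g (l.getD (Nat.pred i) ⟨0, 0, 0, 0, 0, 0⟩) := by
      intro g hg h0
      rw [lane_pack fun f hf => hg f (hl f hf)]
      have h := List.getD_map g (l := l) (n := Nat.pred i) (d := ⟨0, 0, 0, 0, 0, 0⟩)
      rwa [h0] at h
    have hstep : (ofList l).ratios e k (i :: I) acc = (
      force (Nat.pred i) fun i =>
      GridSegment.force (lane (ofList l).u i) (lane (ofList l).v i) (lane (ofList l).x₁ i)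
        (lane (ofList l).y₁ i) (lane (ofList l).x₂ i) (lane (ofList l).y₂ i) fun f =>
      bif e.meets f then (ofList l).ratios e k I acc else
        force (f.area e.x₁ e.y₁) fun x => force (f.area e.x₂ e.y₂) fun y =>
          (ofList l).ratios e k I ((x, y) :: acc)) := rfl
    rw [hstep]
    simp only [force_eq, GridSegment.force_eq, ofList]
    rw [hget _ (fun f hf => hf.u.trans (by norm_num)) rfl,
      hget _ (fun f hf => hf.v.trans (by norm_num)) rfl,
      hget _ (fun f hf => hf.x₁.trans (by norm_num)) rfl,
      hget _ (fun f hf => hf.y₁.trans (by norm_num)) rfl,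
      hget _ (fun f hf => hf.x₂.trans (by norm_num)) rfl,
      hget _ (fun f hf => hf.y₂.trans (by norm_num)) rfl]
    change (bif e.meets (l.getD (Nat.pred i) ⟨0, 0, 0, 0, 0, 0⟩) then (ofList l).ratios e k I acc
      else (ofList l).ratios e k I (e.ratio (l.getD (Nat.pred i) ⟨0, 0, 0, 0, 0, 0⟩) :: acc)) = _
    rw [ih, ih, List.map_cons, List.filter_cons]
    cases e.meets (l.getD (Nat.pred i) ⟨0, 0, 0, 0, 0, 0⟩) <;> simp

end PackedSegments

/-! ### The check of all segments and its soundness -/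

/-- Whether the ratio `x : y` differs from all ratios in the list. -/
def ratioNotIn (x y : ℕ) (l : List (ℕ × ℕ)) : Bool :=
  List.rec (motive := fun _ => Bool) true
    (fun p _ ih => bif Nat.beq (Nat.mul x p.2) (Nat.mul y p.1) then false else ih) l

theorem ratioNotIn_iff {x y : ℕ} {l : List (ℕ × ℕ)} :
    ratioNotIn x y l = true ↔ ∀ p ∈ l, x * p.2 ≠ y * p.1 := by
  induction l with
  | nil => simp [ratioNotIn]
  | cons p l ih =>
    change (bif Nat.beq (x * p.2) (y * p.1) then false else ratioNotIn x y l) = true ↔ _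
    by_cases h : x * p.2 = y * p.1
    · simp [h]
    · simp [natBeq_eq_false h, h, ih]

/-- Whether the ratios in a list are distinct. -/
def distinctRatios : List (ℕ × ℕ) → Bool
  | [] => true
  | p :: l => bif ratioNotIn p.1 p.2 l then distinctRatios l else false

theorem distinctRatios_iff {l : List (ℕ × ℕ)} :
    distinctRatios l = true ↔ l.Pairwise fun p q => p.1 * q.2 ≠ p.2 * q.1 := by
  induction l with
  | nil => simp [distinctRatios]
  | cons p l ih =>
    rw [distinctRatios, List.pairwise_cons, ← ih, ← ratioNotIn_iff]
    cases ratioNotIn p.1 p.2 l <;> simp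

/-- The `k`-th number of a list of numbers with 18 bits each. -/
def coord (X k : ℕ) : ℕ := Nat.mod (Nat.shiftRight X (Nat.mul 18 k)) (Nat.pow 2 18)

theorem coord_lt (X k : ℕ) : coord X k < 2 ^ 18 := Nat.mod_lt _ (by norm_num)

/-- The segment between two points of the list with abscissas `X` and ordinates `Y`. -/
def gridSegment (X Y : ℕ) (p : ℕ × ℕ) : GridSegment :=
  ⟨p.1, p.2, coord X p.1, coord Y p.1, coord X p.2, coord Y p.2⟩

theorem gridSegment_small (X Y : ℕ) {p : ℕ × ℕ} (h1 : p.1 < 2 ^ 18) (h2 : p.2 < 2 ^ 18) :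
    (gridSegment X Y p).Small :=
  ⟨h1, h2, coord_lt _ _, coord_lt _ _, coord_lt _ _, coord_lt _ _⟩

/-- A number whose nonzero lanes are those of the points on the line through `e`, where `PX` and
`PY` are the packed coordinates and `one` has `1` in every lane. -/
def onLineMask (PX PY one : ℕ) (e : GridSegment) : ℕ :=
  force (2 ^ 39 * one) fun B =>
  force (lin e.y₁ e.x₂ (e.x₁ * e.y₂ * one) PX PY) fun p =>
  force (lin e.y₂ e.x₁ (e.y₁ * e.x₂ * one) PX PY) fun q =>
  signs B p q &&& signs B q p

/-- Only the ends of `e` lie on the line through `e`. -/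
def IsolatedOnLine (N X Y : ℕ) (e : GridSegment) : Prop :=
  ∀ k < N, e.pos (coord X k) (coord Y k) = e.neg (coord X k) (coord Y k) → k = e.u ∨ k = e.v

/-- Both comparisons hold exactly for points on the line, so such a point sets bit 39 of its lane.
The prescribed mask has no bits set outside the lanes `e.u` and `e.v`. -/
theorem isolatedOnLine_of_onLineMask_eq {N X Y : ℕ} {e : GridSegment} (he : e.Small)
    (h : onLineMask (pack (coord X) (List.range N)) (pack (coord Y) (List.range N))
      (pack (fun _ => 1) (List.range N)) e =
      2 ^ (40 * e.u + 39) ^^^ 2 ^ (40 * e.v + 39)) : IsolatedOnLine N X Y e := by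
  intro k hk hpq
  simp only [onLineMask, force_eq, ← pack_const (_ * _), lin_pack] at h
  change (signs _ (pack (fun i => e.pos (coord X i) (coord Y i)) _)
    (pack (fun i => e.neg (coord X i) (coord Y i)) _) &&&
    signs _ (pack (fun i => e.neg (coord X i) (coord Y i)) _)
    (pack (fun i => e.pos (coord X i) (coord Y i)) _)) = _ at h
  rw [signs_pack (fun i _ => he.pos_lt (coord_lt X i) (coord_lt Y i))
      (fun i _ => he.neg_lt (coord_lt X i) (coord_lt Y i)),
    signs_pack (fun i _ => he.neg_lt (coord_lt X i) (coord_lt Y i))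
      (fun i _ => he.pos_lt (coord_lt X i) (coord_lt Y i)), and_pack_cond] at h
  have hlane := congrArg (fun K => (lane K k).testBit 39) h
  rw [lane_pack (fun i _ => by cases (_ && _) <;> norm_num)] at hlane
  have hble : (Nat.ble (e.neg (coord X k) (coord Y k)) (e.pos (coord X k) (coord Y k)) &&
      Nat.ble (e.pos (coord X k) (coord Y k)) (e.neg (coord X k) (coord Y k))) = true := by
    rw [hpq, Nat.ble_eq_true_of_le le_rfl]; rfl
  simp only [List.getD_eq_getElem?_getD, List.getElem?_map, List.getElem?_range hk] at hlane
  change ((bif Nat.ble (e.neg (coord X k) (coord Y k)) (e.pos (coord X k) (coord Y k)) &&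
      Nat.ble (e.pos (coord X k) (coord Y k)) (e.neg (coord X k) (coord Y k)) then 2 ^ 39
      else 0).testBit 39) = _ at hlane
  rw [hble, cond_true, Nat.testBit_two_pow_self, lane_eq, Nat.testBit_mod_two_pow, Nat.testBit_shiftRight, Nat.testBit_xor,
    Nat.testBit_two_pow, Nat.testBit_two_pow] at hlane
  by_contra! hne
  simp [hne.1.symm, hne.2.symm] at hlane

/-- The number of crossing pairs in a list of segments. -/
def crossingCount : List GridSegment → ℕ
  | [] => 0
  | e :: l => crossingCount l + (l.filter e.crosses).length

/-- No segment crosses two of the following segments in the same point. -/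
def DistinctCrossings : List GridSegment → Prop
  | [] => True
  | e :: l => (l.filter e.crosses).Pairwise
      (fun f g => (e.ratio f).1 * (e.ratio g).2 ≠ (e.ratio f).2 * (e.ratio g).1) ∧
      DistinctCrossings l

/-- Adds the segments between the listed pairs of points one by one to `T`, and checks that
no other point lies on their lines, that no three of them are concurrent, and that the number of
crossings, starting from `c`, is `t`. The number `1024 * e.u + e.v` in the lowest lane of the mask
has no meaning; it spares the kernel hash collisions. -/
def checkSegments (X Y PX PY one t : ℕ) : List (ℕ × ℕ) → PackedSegments → ℕ → Bool
  | [], _, c => Nat.beq c t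
  | p :: ps, T, c =>
    GridSegment.force p.1 p.2 (coord X p.1) (coord Y p.1) (coord X p.2) (coord Y p.2) fun e =>
    bif Nat.beq (onLineMask PX PY one e) (2 ^ (40 * e.u + 39) ^^^ 2 ^ (40 * e.v + 39)) then
      force (2 ^ 40 * T.crossMask e + (1024 * e.u + e.v)) fun K =>
      T.ratios e (fun r => bif distinctRatios r then
          force (c + r.length) fun c => T.cons e fun T => checkSegments X Y PX PY one t ps T c
        else false) (nonzeroLanes K 10 1 []) []
    else false

/-- Loop invariant: `T` packs the segments `l` treated so far, and `c` is their number of crossings.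
The bound is `1024 = 2 ^ 10` because the masks are searched to depth `10`. -/
theorem checkSegments_spec {N X Y t : ℕ} (ps : List (ℕ × ℕ))
    (hps : ∀ p ∈ ps, p.1 < 2 ^ 18 ∧ p.2 < 2 ^ 18) : ∀ (l : List GridSegment),
    (∀ e ∈ l, e.Small) → ps.length + l.length ≤ 1024 →
    checkSegments X Y (pack (coord X) (List.range N)) (pack (coord Y) (List.range N))
      (pack (fun _ => 1) (List.range N)) t ps (PackedSegments.ofList l) (crossingCount l) = true →
    DistinctCrossings l → (∀ e ∈ l, IsolatedOnLine N X Y e) →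
    crossingCount ((ps.map (gridSegment X Y)).reverse ++ l) = t ∧
      DistinctCrossings ((ps.map (gridSegment X Y)).reverse ++ l) ∧
      ∀ e ∈ (ps.map (gridSegment X Y)).reverse ++ l, IsolatedOnLine N X Y e := by
  induction ps with
  | nil =>
    intro l _ _ h hd hi
    exact ⟨Nat.eq_of_beq_eq_true h, hd, hi⟩
  | cons p ps ih =>
    intro l hl hlen h hd hi
    obtain ⟨hp1, hp2⟩ := hps p (by simp)
    have he := gridSegment_small X Y hp1 hp2
    rw [List.map_cons, List.reverse_cons, List.append_assoc, List.singleton_append]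
    rw [checkSegments, GridSegment.force_eq, ← gridSegment] at h
    generalize gridSegment X Y p = e at *
    rw [Bool.cond_eq_ite] at h
    split at h
    on_goal 2 => cases h
    rename_i hmask
    have hiso := isolatedOnLine_of_onLineMask_eq he (Nat.eq_of_beq_eq_true hmask)
    have hlabel : 1024 * e.u + e.v < 2 ^ 40 := by
      have := he.u; have := he.v; omega
    rw [force_eq, PackedSegments.ratios_ofList hl, PackedSegments.crossMask_ofList hl he,
      map_nonzeroLanes (fun f _ => by cases (_ && _) <;> norm_num) _ hlabel
        (by simp at hlen ⊢; omega), List.append_nil] at h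
    -- The mask tests mutual separation only; pairs with a common end are discarded when the ratios
    -- are formed.
    have hfilter : (l.filter fun f => (bif f.separates e && e.separates f then 2 ^ 39 else 0) != 0).filter
        (fun f => !e.meets f) = l.filter e.crosses := by
      rw [List.filter_filter]
      refine List.filter_congr fun f _ => ?_
      rw [GridSegment.crosses]
      cases f.separates e && e.separates f <;> cases e.meets f <;> rfl
    rw [hfilter, Bool.cond_eq_ite] at h
    split at h
    on_goal 2 => cases h
    rename_i hdist
    rw [distinctRatios_iff, List.pairwise_reverse, List.pairwise_map] at hdist
    rw [force_eq, PackedSegments.cons_ofList, List.length_reverse, List.length_map] at h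
    refine ih (fun q hq => hps q (by simp [hq])) (e :: l) ?_ ?_ h ⟨?_, hd⟩ ?_
    · simpa [he] using hl
    · simp at hlen ⊢; omega
    · refine hdist.imp fun h h' => h ?_
      rw [mul_comm, ← h', mul_comm]
    · simpa [hiso] using hi

/-- Checks the straight-line drawing of the augmented cube with coordinates `X` and `Y`. -/
def checkCube (n X Y t : ℕ) : Bool :=
  force (pack (coord X) (List.range (2 ^ n))) fun PX =>
  force (pack (coord Y) (List.range (2 ^ n))) fun PY =>
  force (pack (fun _ => 1) (List.range (2 ^ n))) fun one =>
  checkSegments X Y PX PY one t (cubeEdges n) (PackedSegments.ofList []) 0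

/-- The segments of the drawing of the augmented cube with coordinates `X` and `Y`. -/
def cubeSegments (n X Y : ℕ) : List GridSegment := ((cubeEdges n).map (gridSegment X Y)).reverse

theorem checkCube_spec {n X Y t : ℕ} (hn : n ≤ 18) (hlen : (cubeEdges n).length ≤ 1024)
    (h : checkCube n X Y t = true) : crossingCount (cubeSegments n X Y) = t ∧
      DistinctCrossings (cubeSegments n X Y) ∧
      ∀ e ∈ cubeSegments n X Y, IsolatedOnLine (2 ^ n) X Y e := by
  simp only [checkCube, force_eq] at h
  have := checkSegments_spec (cubeEdges n) (fun p hp => ?_) [] (by simp) (by simpa using hlen) h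
    trivial (by simp)
  · rwa [List.append_nil] at this
  · have h1 := cubeEdges_lt n p hp
    have h2 : 2 ^ n ≤ 2 ^ 18 := Nat.pow_le_pow_right (by norm_num) hn
    omega

/-! ### From lists of segments to sets of crossings -/

/-- The list is traversed once: the pairs that contain its head correspond to the later segments
that the head crosses. Symmetry of `R` makes one order of each pair sufficient. -/
theorem encard_crossing_pairs {β : Type*} {F : GridSegment → β}
    {R : GridSegment → GridSegment → Prop} (hR : ∀ e f, R e f → R f e) :
    ∀ l : List GridSegment, l.Nodup → (∀ e ∈ l, ∀ f ∈ l, F e = F f → e = f) →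
    (∀ e ∈ l, ∀ f ∈ l, e ≠ f → (e.crosses f = true ↔ R e f)) →
    {z : Sym2 β | ∃ e ∈ l, ∃ f ∈ l, e ≠ f ∧ z = s(F e, F f) ∧ R e f}.encard = crossingCount l
  | [], _, _, _ => by simp [crossingCount]
  | a :: l, hl, hF, hc => by
    classical
    obtain ⟨hal, hl'⟩ := List.nodup_cons.1 hl
    have ih := encard_crossing_pairs hR l hl' (fun e he f hf => hF e (by simp [he]) f (by simp [hf]))
      fun e he f hf => hc e (by simp [he]) f (by simp [hf])
    have hne : ∀ f ∈ l, a ≠ f := fun f hf h => hal (h ▸ hf)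
    have hset : {z : Sym2 β | ∃ e ∈ a :: l, ∃ f ∈ a :: l, e ≠ f ∧ z = s(F e, F f) ∧ R e f} =
        {z : Sym2 β | ∃ e ∈ l, ∃ f ∈ l, e ≠ f ∧ z = s(F e, F f) ∧ R e f} ∪
        (fun f => s(F a, F f)) '' {f | f ∈ (l.filter a.crosses).toFinset} := by
      ext z
      simp only [Set.mem_union, Set.mem_ofPred_eq, Set.mem_image, List.mem_toFinset, List.mem_filter]
      constructor
      · rintro ⟨e, he, f, hf, hef, rfl, h⟩
        rcases List.mem_cons.1 he with rfl | he' <;> rcases List.mem_cons.1 hf with rfl | hf'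
        · exact absurd rfl hef
        · exact .inr ⟨f, ⟨hf', (hc e he f hf hef).2 h⟩, rfl⟩
        · exact .inr ⟨e, ⟨he', (hc f hf e he hef.symm).2 (hR _ _ h)⟩, Sym2.eq_swap⟩
        · exact .inl ⟨e, he', f, hf', hef, rfl, h⟩
      · rintro (⟨e, he, f, hf, hef, rfl, h⟩ | ⟨f, ⟨hf, h⟩, rfl⟩)
        · exact ⟨e, by simp [he], f, by simp [hf], hef, rfl, h⟩
        · exact ⟨a, by simp, f, by simp [hf], hne f hf, rfl,
            (hc a (by simp) f (by simp [hf]) (hne f hf)).1 h⟩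
    have hFa : ∀ f ∈ l, F a ≠ F f := fun f hf h => hne f hf (hF a (by simp) f (by simp [hf]) h)
    have hdis : Disjoint {z : Sym2 β | ∃ e ∈ l, ∃ f ∈ l, e ≠ f ∧ z = s(F e, F f) ∧ R e f}
        ((fun f => s(F a, F f)) '' {f | f ∈ (l.filter a.crosses).toFinset}) := by
      rw [Set.disjoint_left]
      rintro z ⟨e, he, f, hf, -, rfl, -⟩ ⟨g, -, h⟩
      rcases Sym2.eq_iff.1 h with ⟨h, -⟩ | ⟨h, -⟩
      exacts [hFa e he h, hFa f hf h]
    have hinj : Set.InjOn (fun f => s(F a, F f)) {f | f ∈ (l.filter a.crosses).toFinset} := by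
      intro f hf g hg h
      simp only [Set.mem_ofPred_eq, List.mem_toFinset, List.mem_filter] at hf hg
      exact hF f (by simp [hf.1]) g (by simp [hg.1]) (Sym2.congr_right.1 h)
    rw [hset, Set.encard_union_eq hdis, ih, hinj.encard_image, Finset.setOfPred_mem, Set.encard_coe_eq_coe_finsetCard,
      List.toFinset_card_of_nodup (hl'.filter _), crossingCount]
    push_cast
    rfl

/-- Of three segments through `x`, the one that comes first in the list crosses the other two with
equal ratios, which `DistinctCrossings` forbids. -/
theorem not_concurrent_of_distinctCrossings {β : Type*} {S : GridSegment → Set β} {x : β} :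
    ∀ l : List GridSegment, DistinctCrossings l →
    (∀ e ∈ l, ∀ f ∈ l, ∀ g ∈ l, x ∈ S e → x ∈ S f → x ∈ S g →
      (e.ratio f).1 * (e.ratio g).2 = (e.ratio f).2 * (e.ratio g).1) →
    (∀ e ∈ l, ∀ f ∈ l, e ≠ f → x ∈ S e → x ∈ S f → e.crosses f = true) →
    ∀ e ∈ l, ∀ f ∈ l, ∀ g ∈ l, e ≠ f → f ≠ g → e ≠ g → ¬ (x ∈ S e ∧ x ∈ S f ∧ x ∈ S g)
  | [], _, _, _ => by simp
  | a :: l, hl, hS, hc => by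
    have ih := not_concurrent_of_distinctCrossings l hl.2
      (fun e he f hf g hg => hS e (by simp [he]) f (by simp [hf]) g (by simp [hg]))
      fun e he f hf => hc e (by simp [he]) f (by simp [hf])
    have head : ∀ f ∈ l, ∀ g ∈ l, a ≠ f → f ≠ g → a ≠ g → ¬ (x ∈ S a ∧ x ∈ S f ∧ x ∈ S g) := by
      rintro f hf g hg haf hfg hag ⟨ha, hxf, hxg⟩
      have hf' : f ∈ l.filter a.crosses :=
        List.mem_filter.2 ⟨hf, hc a (by simp) f (by simp [hf]) haf ha hxf⟩
      have hg' : g ∈ l.filter a.crosses :=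
        List.mem_filter.2 ⟨hg, hc a (by simp) g (by simp [hg]) hag ha hxg⟩
      -- Symmetry allows the pairwise condition to be used whichever of `f` and `g` comes first.
      have : Std.Symm fun f g : GridSegment =>
          (a.ratio f).1 * (a.ratio g).2 ≠ (a.ratio f).2 * (a.ratio g).1 :=
        ⟨fun p q h h' => h (by rw [mul_comm, ← h', mul_comm])⟩
      exact hl.1.forall hf' hg' hfg
        (hS a (by simp) f (by simp [hf]) g (by simp [hg]) ha hxf hxg)
    intro e he f hf g hg hef hfg heg
    rcases List.mem_cons.1 he with rfl | he' <;> rcases List.mem_cons.1 hf with rfl | hf' <;>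
      rcases List.mem_cons.1 hg with rfl | hg'
    · exact absurd rfl hef
    · exact absurd rfl hef
    · exact absurd rfl heg
    · exact head f hf' g hg' hef hfg heg
    · exact absurd rfl hfg
    · exact fun h => head e he' g hg' hef.symm heg hfg ⟨h.2.1, h.1, h.2.2⟩
    · exact fun h => head e he' f hf' heg.symm hef hfg.symm ⟨h.2.2, h.1, h.2.1⟩
    · exact ih e he' f hf' g hg' hef hfg heg

/-! ### Integer tests and real geometry -/

/-- The `k`-th point of the list with abscissas `X` and ordinates `Y`. -/
def gridPoint (X Y k : ℕ) : ℝ × ℝ := (coord X k, coord Y k)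

theorem orient_gridPoint (X Y : ℕ) (p : ℕ × ℕ) (k : ℕ) :
    orient (gridPoint X Y p.1) (gridPoint X Y p.2) (gridPoint X Y k) =
      (gridSegment X Y p).pos (coord X k) (coord Y k) -
      (gridSegment X Y p).neg (coord X k) (coord Y k) := by
  simp only [orient, gridPoint, gridSegment, GridSegment.pos, GridSegment.neg, lin_eq, Nat.mul_eq]
  push_cast
  ring

theorem left_iff_orient_nonneg (X Y : ℕ) (p : ℕ × ℕ) (k : ℕ) :
    (gridSegment X Y p).left (coord X k) (coord Y k) = true ↔
      0 ≤ orient (gridPoint X Y p.1) (gridPoint X Y p.2) (gridPoint X Y k) := by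
  rw [orient_gridPoint, sub_nonneg, Nat.cast_le]
  exact ⟨Nat.le_of_ble_eq_true, Nat.ble_eq_true_of_le⟩

theorem area_eq_abs_orient (X Y : ℕ) (p : ℕ × ℕ) (k : ℕ) :
    ((gridSegment X Y p).area (coord X k) (coord Y k) : ℝ) =
      |orient (gridPoint X Y p.1) (gridPoint X Y p.2) (gridPoint X Y k)| := by
  rw [orient_gridPoint, GridSegment.area]
  generalize (gridSegment X Y p).pos (coord X k) (coord Y k) = a
  generalize (gridSegment X Y p).neg (coord X k) (coord Y k) = b
  change ((a - b + (b - a) : ℕ) : ℝ) = _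
  rcases le_total a b with h | h
  · rw [Nat.sub_eq_zero_of_le h, zero_add, Nat.cast_sub h, abs_of_nonpos (by simpa using h)]
    ring
  · rw [Nat.sub_eq_zero_of_le h, add_zero, Nat.cast_sub h, abs_of_nonneg (by simpa using h)]

/-- `left` also accepts points on the line; the two hypotheses make this harmless. -/
theorem separates_iff {X Y : ℕ} {p q : ℕ × ℕ}
    (h1 : orient (gridPoint X Y p.1) (gridPoint X Y p.2) (gridPoint X Y q.1) ≠ 0)
    (h2 : orient (gridPoint X Y p.1) (gridPoint X Y p.2) (gridPoint X Y q.2) ≠ 0) :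
    (gridSegment X Y p).separates (gridSegment X Y q) = true ↔
      orient (gridPoint X Y p.1) (gridPoint X Y p.2) (gridPoint X Y q.1) *
      orient (gridPoint X Y p.1) (gridPoint X Y p.2) (gridPoint X Y q.2) < 0 := by
  have e1 := left_iff_orient_nonneg X Y p q.1
  have e2 := left_iff_orient_nonneg X Y p q.2
  change ((gridSegment X Y p).left (coord X q.1) (coord Y q.1)).xor
    ((gridSegment X Y p).left (coord X q.2) (coord Y q.2)) = true ↔ _
  rw [mul_neg_iff]
  generalize orient (gridPoint X Y p.1) (gridPoint X Y p.2) (gridPoint X Y q.1) = x at *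
  generalize orient (gridPoint X Y p.1) (gridPoint X Y p.2) (gridPoint X Y q.2) = y at *
  generalize (gridSegment X Y p).left (coord X q.1) (coord Y q.1) = s at *
  generalize (gridSegment X Y p).left (coord X q.2) (coord Y q.2) = t at *
  rcases lt_or_gt_of_ne h1 with hx | hx <;> rcases lt_or_gt_of_ne h2 with hy | hy <;>
    cases s <;> cases t <;>
    simp [hx, hy, hx.le, hy.le, not_lt.2 hx.le, not_lt.2 hy.le, not_le.2 hx, not_le.2 hy] at e1 e2 ⊢

section CubeDrawing

variable (n X Y : ℕ)

/-- The position of a vertex. -/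
def cubePoint (a : Fin n → Bool) : ℝ × ℝ := gridPoint X Y (vertexCode n a)

/-- The edge of the augmented cube that a segment represents. -/
noncomputable def segmentEdge (e : GridSegment) : Sym2 (Fin n → Bool) :=
  s(Function.invFun (vertexCode n) e.u, Function.invFun (vertexCode n) e.v)

/-- The points of a segment without its ends. -/
def segmentInterior (e : GridSegment) : Set (ℝ × ℝ) :=
  openSegment ℝ (gridPoint X Y e.u) (gridPoint X Y e.v)

variable {n X Y}

theorem vertexCode_invFun {k : ℕ} (hk : k < 2 ^ n) :
    vertexCode n (Function.invFun (vertexCode n) k) = k :=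
  Function.invFun_eq (exists_vertexCode_eq n k hk)

theorem invFun_vertexCode (a : Fin n → Bool) :
    Function.invFun (vertexCode n) (vertexCode n a) = a :=
  Function.leftInverse_invFun (vertexCode_injective n) a

theorem exists_of_mem_cubeSegments {e : GridSegment} (he : e ∈ cubeSegments n X Y) :
    ∃ p ∈ cubeEdges n, e = gridSegment X Y p ∧ p.1 < p.2 ∧ p.2 < 2 ^ n := by
  simp only [cubeSegments, List.mem_reverse, List.mem_map] at he
  obtain ⟨p, hp, rfl⟩ := he
  exact ⟨p, hp, rfl, cubeEdges_lt n p hp⟩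

theorem gridSegment_mem_cubeSegments {p : ℕ × ℕ} (hp : p ∈ cubeEdges n) :
    gridSegment X Y p ∈ cubeSegments n X Y := by
  rw [cubeSegments, List.mem_reverse]
  exact List.mem_map_of_mem hp

theorem nodup_cubeSegments : (cubeSegments n X Y).Nodup := by
  rw [cubeSegments, List.nodup_reverse]
  refine (nodup_cubeEdges n).map fun p q h => ?_
  exact Prod.ext (congrArg GridSegment.u h) (congrArg GridSegment.v h)

/-- The smaller code comes first in every listed pair, so no edge is represented in both directions.
-/
theorem segmentEdge_injOn (e : GridSegment) (he : e ∈ cubeSegments n X Y) (f : GridSegment)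
    (hf : f ∈ cubeSegments n X Y) (h : segmentEdge n e = segmentEdge n f) : e = f := by
  obtain ⟨p, -, rfl, hp, hp'⟩ := exists_of_mem_cubeSegments he
  obtain ⟨q, -, rfl, hq, hq'⟩ := exists_of_mem_cubeSegments hf
  have h' := congrArg (Sym2.map (vertexCode n)) h
  simp only [segmentEdge, Sym2.map_mk, gridSegment] at h'
  rw [vertexCode_invFun (hp.trans hp'), vertexCode_invFun hp', vertexCode_invFun (hq.trans hq'),
    vertexCode_invFun hq'] at h'
  have : p = q := by
    rcases Sym2.eq_iff.1 h' with ⟨h1, h2⟩ | ⟨h1, h2⟩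
    · exact Prod.ext h1 h2
    · omega
  rw [this]

theorem mem_edgeSet_iff_segmentEdge {z : Sym2 (Fin n → Bool)} :
    z ∈ (augmentedCube n).edgeSet ↔ ∃ e ∈ cubeSegments n X Y, segmentEdge n e = z := by
  constructor
  · induction z with | _ a b
    rw [SimpleGraph.mem_edgeSet, augmentedCube_adj_iff]
    rintro (h | h)
    · exact ⟨_, gridSegment_mem_cubeSegments h, by
        simp only [segmentEdge, gridSegment, invFun_vertexCode]⟩
    · refine ⟨_, gridSegment_mem_cubeSegments h, ?_⟩
      simp only [segmentEdge, gridSegment, invFun_vertexCode]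
      exact Sym2.eq_swap
  · rintro ⟨e, he, rfl⟩
    obtain ⟨p, hp, rfl, h1, h2⟩ := exists_of_mem_cubeSegments he
    rw [segmentEdge, SimpleGraph.mem_edgeSet, augmentedCube_adj_iff]
    simp only [gridSegment]
    rw [vertexCode_invFun (h1.trans h2), vertexCode_invFun h2]
    exact .inl hp

theorem openSegmentOf_segmentEdge {e : GridSegment} (he : e ∈ cubeSegments n X Y) :
    openSegmentOf (cubePoint n X Y) (segmentEdge n e) = segmentInterior X Y e := by
  obtain ⟨p, -, rfl, h1, h2⟩ := exists_of_mem_cubeSegments he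
  simp only [segmentEdge, openSegmentOf_mk, cubePoint, gridSegment, segmentInterior]
  rw [vertexCode_invFun (h1.trans h2), vertexCode_invFun h2]

theorem orient_ne_zero_of_isolatedOnLine {N : ℕ} {p : ℕ × ℕ}
    (h : IsolatedOnLine N X Y (gridSegment X Y p)) {k : ℕ} (hk : k < N) (h1 : k ≠ p.1)
    (h2 : k ≠ p.2) :
    orient (gridPoint X Y p.1) (gridPoint X Y p.2) (gridPoint X Y k) ≠ 0 := by
  rw [orient_gridPoint, sub_ne_zero]
  intro h0
  rcases h k hk (Nat.cast_injective h0) with h | h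
  exacts [h1 h, h2 h]

theorem edgesInGeneralPosition_cubePoint
    (hi : ∀ e ∈ cubeSegments n X Y, IsolatedOnLine (2 ^ n) X Y e) :
    EdgesInGeneralPosition (augmentedCube n) (cubePoint n X Y) := by
  intro a b v hab hva hvb
  have hva' := (vertexCode_injective n).ne hva
  have hvb' := (vertexCode_injective n).ne hvb
  rcases (augmentedCube_adj_iff n a b).1 hab with h | h
  · exact orient_ne_zero_of_isolatedOnLine (hi _ (gridSegment_mem_cubeSegments h))
      (vertexCode_lt n v) hva' hvb'
  · rw [orient_swap, neg_ne_zero]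
    exact orient_ne_zero_of_isolatedOnLine (hi _ (gridSegment_mem_cubeSegments h))
      (vertexCode_lt n v) hvb' hva'

/-- With a common end both sides are false, by `meets` and by general position. Otherwise all four
orientations are nonzero and the sign criterion applies. -/
theorem crosses_iff (hi : ∀ e ∈ cubeSegments n X Y, IsolatedOnLine (2 ^ n) X Y e)
    {e f : GridSegment} (he : e ∈ cubeSegments n X Y) (hf : f ∈ cubeSegments n X Y) (hef : e ≠ f) :
    e.crosses f = true ↔ (segmentInterior X Y e ∩ segmentInterior X Y f).Nonempty := by
  have hdis := fun v => disjoint_openSegmentOf_of_common (v := v) (edgesInGeneralPosition_cubePoint hi)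
    (mem_edgeSet_iff_segmentEdge.2 ⟨e, he, rfl⟩) (mem_edgeSet_iff_segmentEdge.2 ⟨f, hf, rfl⟩)
    fun h => hef (segmentEdge_injOn e he f hf h)
  rw [openSegmentOf_segmentEdge he, openSegmentOf_segmentEdge hf] at hdis
  have hie := hi e he
  have hif := hi f hf
  obtain ⟨p, -, rfl, hp, hp'⟩ := exists_of_mem_cubeSegments he
  obtain ⟨q, -, rfl, hq, hq'⟩ := exists_of_mem_cubeSegments hf
  by_cases hm : (gridSegment X Y p).meets (gridSegment X Y q) = true
  · have hcommon : ∃ k, (k = p.1 ∨ k = p.2) ∧ (k = q.1 ∨ k = q.2) := by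
      rcases GridSegment.meets_iff.1 hm with h | h | h | h
      exacts [⟨p.1, .inl rfl, .inl h⟩, ⟨p.1, .inl rfl, .inr h⟩, ⟨p.2, .inr rfl, .inl h⟩,
        ⟨p.2, .inr rfl, .inr h⟩]
    obtain ⟨k, hk1, hk2⟩ := hcommon
    have hd := hdis (Function.invFun (vertexCode n) k)
      (by rcases hk1 with rfl | rfl <;> simp [segmentEdge, gridSegment])
      (by rcases hk2 with rfl | rfl <;> simp [segmentEdge, gridSegment])
    simp [GridSegment.crosses, hm, Set.disjoint_iff_inter_eq_empty.1 hd]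
  · have hne : ¬ (p.1 = q.1 ∨ p.1 = q.2 ∨ p.2 = q.1 ∨ p.2 = q.2) :=
      fun h => hm (GridSegment.meets_iff.2 h)
    push Not at hne
    obtain ⟨h1, h2, h3, h4⟩ := hne
    have o1 := orient_ne_zero_of_isolatedOnLine hie (hq.trans hq') h1.symm h3.symm
    have o2 := orient_ne_zero_of_isolatedOnLine hie hq' h2.symm h4.symm
    have o3 := orient_ne_zero_of_isolatedOnLine hif (hp.trans hp') h1 h2
    have o4 := orient_ne_zero_of_isolatedOnLine hif hp' h3 h4
    rw [GridSegment.crosses, Bool.eq_false_of_not_eq_true hm, Bool.not_false, Bool.and_true,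
      Bool.and_eq_true, separates_iff o3 o4, separates_iff o1 o2, and_comm]
    exact (openSegment_inter_nonempty_iff o1 o3).symm

/-- Passing to absolute values is safe: only the implication from concurrency to equal ratios is
needed. -/
theorem ratio_eq_of_concurrent {e f g : GridSegment} (he : e ∈ cubeSegments n X Y)
    (hf : f ∈ cubeSegments n X Y) (hg : g ∈ cubeSegments n X Y) {x : ℝ × ℝ}
    (hxe : x ∈ segmentInterior X Y e) (hxf : x ∈ segmentInterior X Y f)
    (hxg : x ∈ segmentInterior X Y g) :
    (e.ratio f).1 * (e.ratio g).2 = (e.ratio f).2 * (e.ratio g).1 := by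
  obtain ⟨p, -, rfl, -⟩ := exists_of_mem_cubeSegments he
  obtain ⟨q, -, rfl, -⟩ := exists_of_mem_cubeSegments hf
  obtain ⟨r, -, rfl, -⟩ := exists_of_mem_cubeSegments hg
  have h := congrArg abs (orient_mul_eq_of_concurrent hxe hxf hxg)
  rw [abs_mul, abs_mul] at h
  simp only [gridSegment] at h
  rw [← area_eq_abs_orient, ← area_eq_abs_orient, ← area_eq_abs_orient, ← area_eq_abs_orient] at h
  exact_mod_cast h

/-- This reduces a drawing with `t` crossings to decidable statements about numerals: the bound `n ≤
18` keeps vertex codes below `2 ^ 18`, and `hP` makes the vertices distinct points. -/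
theorem exists_good_drawing_of_checkCube {n X Y t : ℕ} (hn : n ≤ 18)
    (hlen : (cubeEdges n).length ≤ 1024)
    (hP : ((List.range (2 ^ n)).map fun k => (coord X k, coord Y k)).Nodup)
    (h : checkCube n X Y t = true) :
    ∃ D : PlaneDrawing (augmentedCube n), D.IsGood ∧ D.crossings = t := by
  obtain ⟨hcount, hdist, hi⟩ := checkCube_spec hn hlen h
  have hinj : Function.Injective (cubePoint n X Y) := by
    intro a b hab
    have hab' : (coord X (vertexCode n a), coord Y (vertexCode n a)) =
        (coord X (vertexCode n b), coord Y (vertexCode n b)) :=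
      Prod.ext (Nat.cast_injective (congrArg Prod.fst hab))
        (Nat.cast_injective (congrArg Prod.snd hab))
    exact vertexCode_injective n (List.inj_on_of_nodup_map hP
      (List.mem_range.2 (vertexCode_lt n a)) (List.mem_range.2 (vertexCode_lt n b)) hab')
  have hG := edgesInGeneralPosition_cubePoint hi
  have hgood : (straightLineDrawing hinj hG).IsGood := by
    refine isGood_straightLineDrawing hinj hG fun z₁ h₁ z₂ h₂ z₃ h₃ h12 h23 h13 => ?_
    obtain ⟨e, he, rfl⟩ := mem_edgeSet_iff_segmentEdge (X := X) (Y := Y).1 h₁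
    obtain ⟨f, hf, rfl⟩ := mem_edgeSet_iff_segmentEdge (X := X) (Y := Y).1 h₂
    obtain ⟨g, hg, rfl⟩ := mem_edgeSet_iff_segmentEdge (X := X) (Y := Y).1 h₃
    rw [openSegmentOf_segmentEdge he, openSegmentOf_segmentEdge hf, openSegmentOf_segmentEdge hg,
      Set.eq_empty_iff_forall_notMem]
    rintro x ⟨⟨hxe, hxf⟩, hxg⟩
    refine not_concurrent_of_distinctCrossings (S := segmentInterior X Y) _ hdist
      (fun e he f hf g hg => ratio_eq_of_concurrent he hf hg)
      (fun e he f hf hef hxe hxf => (crosses_iff hi he hf hef).2 ⟨x, hxe, hxf⟩)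
      e he f hf g hg ?_ ?_ ?_ ⟨hxe, hxf, hxg⟩ <;> rintro rfl
    exacts [h12 rfl, h23 rfl, h13 rfl]
  refine ⟨_, hgood, ?_⟩
  rw [crossings_straightLineDrawing hinj hG hgood, ← hcount,
    ← encard_crossing_pairs (F := segmentEdge n)
      (R := fun e f => (segmentInterior X Y e ∩ segmentInterior X Y f).Nonempty)
      (fun e f h => by rwa [Set.inter_comm]) _ nodup_cubeSegments segmentEdge_injOn
      fun e he f hf hef => crosses_iff hi he hf hef]
  congr 1
  ext z
  constructor
  · rintro ⟨z₁, h₁, z₂, h₂, hne, rfl, hx⟩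
    obtain ⟨e, he, rfl⟩ := (mem_edgeSet_iff_segmentEdge (X := X) (Y := Y)).1 h₁
    obtain ⟨f, hf, rfl⟩ := (mem_edgeSet_iff_segmentEdge (X := X) (Y := Y)).1 h₂
    rw [openSegmentOf_segmentEdge he, openSegmentOf_segmentEdge hf] at hx
    exact ⟨e, he, f, hf, fun h => hne (by rw [h]), rfl, hx⟩
  · rintro ⟨e, he, f, hf, hne, rfl, hx⟩
    rw [← openSegmentOf_segmentEdge he, ← openSegmentOf_segmentEdge hf] at hx
    exact ⟨_, mem_edgeSet_iff_segmentEdge.2 ⟨e, he, rfl⟩, _,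
      mem_edgeSet_iff_segmentEdge.2 ⟨f, hf, rfl⟩, fun h => hne (segmentEdge_injOn e he f hf h),
      rfl, hx⟩

end CubeDrawing

/-! Coordinates of the vertices of the drawings, found by simulated annealing. -/

/-- The abscissas of the vertices of `AQ_4`. -/
def cubeX4 : ℕ :=
  0xe0d48d091585c46c51c924857f20c4c6e4b17808cbd7374c068363e5eccb862671c2d0f

/-- The ordinates of the vertices of `AQ_4`. -/
def cubeY4 : ℕ :=
  0x532844000bcb02ab9261a8629314ffc8ec93dc7025b006bb0dad1018e8216f0d3ac0731

/-- The abscissas of the vertices of `AQ_5`. -/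
def cubeX5 : ℕ :=
  0x399f4c00a37b1cbeea25b305aa82610093c938044c9ae36c24c91932ed0fd1033048f1a209fbc1a050072836810e53c10300a41836b322f2c4f7f11ec0586011fd80c8a0857c2909

/-- The ordinates of the vertices of `AQ_5`. -/
def cubeY5 : ℕ :=
  0x39ae4371f05f80a7d926e04360310984b3bf35ac473ca084d0788f2ab4c0c970d790f09e3f41438e404570b5ae226ec257a17c20b8532caf046b6092989ae52bea41e8b0f454fb09

/-- The abscissas of the vertices of `AQ_6`. -/
def cubeX6 : ℕ :=
  0x115b8286c02d9052e11d020e4f03461c8c601e398d3aa3f2546f511671804cf06008455111ddc351a04a2c74271da88dd1131a049b56283b4b9c136238806512a7c146c0e7dc3ca70e95c1b3f00ec04f171ca20d4f228b087c2a1e4e4a9933a33867b615860005b0598c478b0dd9825780289461e818caca913242647a52235b48ebd2a6d077d410f740f580ba48308b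

/-- The ordinates of the vertices of `AQ_6`. -/
def cubeY6 : ℕ :=
  0x27accd2ff3c4208700178f4d3d831fb07fe90ed0cc84537aec508f1d144f6383845098f52d96cc9ec3bd38a9d72abfcd0ea31bb8b3e12d5b0b96c33a00ab6f2a9bceb7e2f940ba520d0b01686024d84b580c66c08fe05a642ee50d720150b011a842ec16694077205584736f07cd018cc02d68238c08d1c0cbc05aa81d17065ec195f04a5020a9088ac0f29074701ea7

/-- The abscissas of the vertices of `AQ_7`. -/
def cubeX7 : ℕ :=
  0x3fc78af9c090694567726cfa152bfc520b64863530938f3985a76d4a1d41ab0278c10d6f3f2308b6e045292532633dfe49cc5dd1f62979f8f26ecffb2db5b54d00c0b4d1ddc8f8d73afacc9080d155697b7588b9344b10621546a5ddaa355d6815aa1350ab8529633471279440240d0801d6092c1e691cb32b6a7cea9e9a8d6e6c3d7ce1620b4167fa872c435c18e5b9323105d530800d135f6c9cf4835a5859ddd27ebd69f38dbf8981f144450174a16c20e51d3f2d04532004c9248e5faafb977b20e9ef3a7822eafa0e3b25af8d4a03813f1144f4f8cf271dc6e57086a122176d3c7205196405d2bb839be42f0b42b942703f3ac3ed31ff3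0e0d12f11c89d20fc38f06c58832ce4a9084e10f37ffb226cab33bdb6ef491a03f1225e109885

/-- The ordinates of the vertices of `AQ_7`. -/
def cubeY7 : ℕ :=
  0xa09ab391ff2db5fc9c7e51b5996beb41ffea8044afc4bd88017da876eafcf65cf7de3d6f67cd341f0f6c1d9d5056da76c51bfcdcf7c8454570eace17493cf86695fe1f5d6e9d9a75c3f6b29a5eff5ecddeaf00f57febc83ab8cfb0b26da8fcd3e6bba1b639ba4a8c998ae0e3ba63f1f32dd9b6dd669040311c7b3a42cd7cad146f1d6ca202b775ade57972cc89df15d92b7e44e480c058d93b31bf81ede15704b97a2da3c52e204539126640bf82b3a130bccac26444842d6089195b2a47eb4028512544e1c639148526a02cb4fc2c55f802a2a1290596551a23c52f00c0d8ad2f25ab0230c183408b151c15460740b68493d62120834aa153bc80561c73c5c840d67c81a1251302fb71853c6fea1df3070090ced08a2723358377b18e8865a6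

theorem exists_good_drawing_augmentedCube_4 :
    ∃ D : PlaneDrawing (augmentedCube 4), D.IsGood ∧ D.crossings = 46 :=
  exists_good_drawing_of_checkCube (X := cubeX4) (Y := cubeY4) (by norm_num) (by decide +kernel)
    (by decide +kernel) (by decide +kernel)

theorem exists_good_drawing_augmentedCube_5 :
    ∃ D : PlaneDrawing (augmentedCube 5), D.IsGood ∧ D.crossings = 328 :=
  exists_good_drawing_of_checkCube (X := cubeX5) (Y := cubeY5) (by norm_num) (by decide +kernel)
    (by decide +kernel) (by decide +kernel)

theorem exists_good_drawing_augmentedCube_6 :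
    ∃ D : PlaneDrawing (augmentedCube 6), D.IsGood ∧ D.crossings = 1848 :=
  exists_good_drawing_of_checkCube (X := cubeX6) (Y := cubeY6) (by norm_num) (by decide +kernel)
    (by decide +kernel) (by decide +kernel)

theorem exists_good_drawing_augmentedCube_7 :
    ∃ D : PlaneDrawing (augmentedCube 7), D.IsGood ∧ D.crossings = 9112 :=
  exists_good_drawing_of_checkCube (X := cubeX7) (Y := cubeY7) (by norm_num) (by decide +kernel)
    (by decide +kernel) (by decide +kernel)

theorem crossingNumber_le_of_drawing {V : Type*} {G : SimpleGraph V} {t : ℕ∞}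
    (h : ∃ D : PlaneDrawing G, D.IsGood ∧ D.crossings = t) : crossingNumber G ≤ t := by
  obtain ⟨D, hD, rfl⟩ := h
  exact iInf₂_le D hD

theorem mainTheorem3 :
    ((∃ D : PlaneDrawing (augmentedCube 4), D.IsGood ∧ D.crossings = 46) ∧
      (∃ D : PlaneDrawing (augmentedCube 5), D.IsGood ∧ D.crossings = 328) ∧
      (∃ D : PlaneDrawing (augmentedCube 6), D.IsGood ∧ D.crossings = 1848) ∧
      (∃ D : PlaneDrawing (augmentedCube 7), D.IsGood ∧ D.crossings = 9112)) ∧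
    crossingNumber (augmentedCube 4) ≤ 46 ∧
    crossingNumber (augmentedCube 5) ≤ 328 ∧
    crossingNumber (augmentedCube 6) ≤ 1848 ∧
    crossingNumber (augmentedCube 7) ≤ 9112 :=
  ⟨⟨exists_good_drawing_augmentedCube_4, exists_good_drawing_augmentedCube_5,
    exists_good_drawing_augmentedCube_6, exists_good_drawing_augmentedCube_7⟩,
    crossingNumber_le_of_drawing exists_good_drawing_augmentedCube_4,
    crossingNumber_le_of_drawing exists_good_drawing_augmentedCube_5,
    crossingNumber_le_of_drawing exists_good_drawing_augmentedCube_6,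
    crossingNumber_le_of_drawing exists_good_drawing_augmentedCube_7⟩
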